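/- Setting. Let $d\ge 1$ and let $\phi:\mathbb R^d\to\mathbb R$ be convex quadratic with positive semidefinite Hessian $A\in\mathbb R^{d\times d}$, that is, $\phi(y)=\phi(x)+\langle\nabla\phi(x),y-x\rangle+\frac12 (y-x)^\top A(y-x)$ for all $x,y$. Assume that $\phi$ is $\mu$-strongly convex, $\mu>0$, with minimizer $x^*$, and write $\phi^*=\phi(x^*)$. A (measurable) oracle $f$ satisfies $|f(x)-\phi(x)|\le\sigma$ for all $x$. A random matrix $S\in\mathbb R^{d\times\ell}$ is an oblivious $(\gamma,k,\delta)$-sketching matrix if for every fixed $B\in\mathbb R^{d\times d}$, with probability at least $1-\delta$, $\|B^\top SS^\top B-B^\top B\|_2\le\gamma\,(\|B\|_2^2+\|B\|_F^2/k)$. Algorithm 1, with smoothing parameter $\alpha>0$, starting point $x_0$ and independent random matrices $S_0,\dots,S_{T-1}\in\mathbb R^{d\times \ell}$, where $S_t$ has columns $s_t^{(1)},\dots,s_t^{(\ell)}$, iterates $$x_{t+1}=x_t-\eta\sum_{i=1}^{\ell}\frac{f(x_t+\alpha s_t^{(i)})-f(x_t-\alpha s_t^{(i)})}{2\alpha}\,s_t^{(i)},\qquad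 \eta=\Big(5\|A\|_2+\frac{\mathrm{tr}(A)}{k}\Big)^{-1}.$$ Statement. There is a universal constant $c>0$ such that, for all $k\ge1$ and $\delta'\in(0,1)$, the Gaussian sketch (i.i.d. $N(0,1/\ell)$ entries) and the Rademacher sketch (i.i.d. entries uniform on $\{\pm1/\sqrt\ell\}$) in $\mathbb R^{d\times\ell}$ are oblivious $(\frac14,k,\delta')$-sketching matrices as soon as $\ell\ge c\,(k+\log\frac1{\delta'})$. Moreover, for every $C_1>0$ there are constants $C,C'>0$, depending only on $C_1$, such that the following holds. Let $T\ge1$, $k\ge1$, $\delta\in(0,1)$, $\varepsilon>0$, and let $S_0,\dots,S_{T-1}$ be independent oblivious $(\frac14,k,\frac\delta T)$-sketching matrices (for instance, Gaussian or Rademacher ones with $\ell\ge c\,(k+\log\frac T\delta)$), with $\ell\le C_1(k+\log\frac T\delta)$ and $k>\log\frac T\delta$. Put $\Lambda=\log\frac{\max\{1,\phi(x_0)-\phi^*\}}{\varepsilon}$. (1) If $T\ge C\Big(\frac{\|A\|_2}{\mu}+\frac{\mathrm{tr}(A)}{\mu\ell}\Big)\Lambda$, then with probability at least $1-\delta$,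 $$\phi(x_T)-\phi^*\le\varepsilon+\frac{3\ell\sigma^2}{\mu\alpha^2}.$$ (2) If $\varepsilon\le\frac12$ and $T\le\Big\lceil C\Big(\frac{\|A\|_2}{\mu}+\frac{\mathrm{tr}(A)}{\mu\ell}\Big)\Lambda\Big\rceil$, then the total number of queries that Algorithm 1 makes to $f$ is at most $$C'\Big(\frac{\ell\|A\|_2}{\mu}+\frac{\mathrm{tr}(A)}{\mu}\Big)\Lambda .$$ Here $\Lambda=O(\log\frac1\varepsilon)$: it equals $\log\frac1\varepsilon$ if $\phi(x_0)-\phi^*\le1$, and it is at most $2\log\frac1\varepsilon$ if $\varepsilon\le\min\{\frac12,\frac{1}{\phi(x_0)-\phi^*}\}$. So $T=O\big((\frac{\|A\|_2}{\mu}+\frac{\mathrm{tr}(A)}{\mu\ell})\log\frac1\varepsilon\big)$ iterations suffice, with $\tilde O\big((\frac{\ell\|A\|_2}{\mu}+\frac{\mathrm{tr}(A)}{\mu})\log\frac1\varepsilon\big)$ queries. -/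

import Mathlib

open MeasureTheory ProbabilityTheory
open scoped ENNReal NNReal Gradient

noncomputable section

/-! ### Matrices -/

/-- The spectral norm of a real matrix. -/
def specNorm {m n : ℕ} (A : Matrix (Fin m) (Fin n) ℝ) : ℝ :=
  ‖LinearMap.toContinuousLinearMap (Matrix.toEuclideanLin A)‖

/-- The squared Frobenius norm of a real matrix. -/
def frobSq {m n : ℕ} (A : Matrix (Fin m) (Fin n) ℝ) : ℝ := ∑ i, ∑ j, A i j ^ 2

/-- Matrices carry the product (entrywise Borel) sigma-algebra. -/
instance matrixMeasurableSpace (m n : ℕ) : MeasurableSpace (Matrix (Fin m) (Fin n) ℝ) :=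
  inferInstanceAs (MeasurableSpace (Fin m → Fin n → ℝ))

/-! ### Oblivious sketching matrices -/

/-- A law `ν` on `d × ℓ` matrices is that of an oblivious `(γ, k, δ)`-sketching matrix for the
matrix product: for every fixed matrix `A`, a matrix `S` drawn from `ν` satisfies
`‖Aᵀ S Sᵀ A - Aᵀ A‖₂ ≤ γ (‖A‖₂² + ‖A‖_F² / k)` with probability at least `1 - δ`. -/
def IsObliviousSketch {d ℓ : ℕ} (ν : Measure (Matrix (Fin d) (Fin ℓ) ℝ)) (γ k δ : ℝ) : Prop :=
  ∀ A : Matrix (Fin d) (Fin d) ℝ,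
    1 - δ ≤ ν.real {S | specNorm (A.transpose * S * S.transpose * A - A.transpose * A)
      ≤ γ * (specNorm A ^ 2 + frobSq A / k)}

/-- The law of the `d × ℓ` matrix with i.i.d. entries of law `ρ`. -/
def iidMatrix (d ℓ : ℕ) (ρ : Measure ℝ) : Measure (Matrix (Fin d) (Fin ℓ) ℝ) :=
  (Measure.pi fun _ : Fin d => Measure.pi fun _ : Fin ℓ => ρ).map Matrix.of

/-- Gaussian sketch: i.i.d. centered Gaussian entries of variance `1 / ℓ`. -/
def gaussianSketch (d ℓ : ℕ) : Measure (Matrix (Fin d) (Fin ℓ) ℝ) :=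
  iidMatrix d ℓ (gaussianReal 0 ((ℓ : ℝ≥0)⁻¹))

/-- Rademacher sketch: i.i.d. entries, uniform on `{1 / √ℓ, -1 / √ℓ}`. -/
def rademacherSketch (d ℓ : ℕ) : Measure (Matrix (Fin d) (Fin ℓ) ℝ) :=
  iidMatrix d ℓ ((2⁻¹ : ℝ≥0∞) • Measure.dirac (1 / √(ℓ : ℝ)) +
    (2⁻¹ : ℝ≥0∞) • Measure.dirac (-(1 / √(ℓ : ℝ))))

/-! ### The objective -/

/-- `φ` is convex quadratic with Hessian matrix `A`; here `‖v‖_A² = vᵀ A v`. -/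
structure IsConvexQuadratic {d : ℕ} (φ : EuclideanSpace ℝ (Fin d) → ℝ)
    (A : Matrix (Fin d) (Fin d) ℝ) : Prop where
  posSemidef : A.PosSemidef
  differentiable : Differentiable ℝ φ
  expansion : ∀ x y, φ y = φ x + inner ℝ (∇ φ x) (y - x) +
    1 / 2 * inner ℝ (y - x) (Matrix.toEuclideanLin A (y - x))

/-! ### Programs with access to a zeroth-order oracle -/

/-- Programs with output in `β` which may query a real-valued oracle on `X`. -/
inductive OracleProg (X β : Type) : Type
  | pure (b : β) : OracleProg X β
  | query (x : X) (next : ℝ → OracleProg X β) : OracleProg X β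

namespace OracleProg

variable {X β γ : Type}

/-- Sequential composition. -/
def bind : OracleProg X β → (β → OracleProg X γ) → OracleProg X γ
  | pure b, g => g b
  | query x next, g => query x fun r => (next r).bind g

/-- The output of the program when the oracle is `f`. -/
def run (f : X → ℝ) : OracleProg X β → β
  | pure b => b
  | query x next => (next (f x)).run f

/-- The number of oracle queries that the program makes when the oracle is `f`. -/
def queries (f : X → ℝ) : OracleProg X β → ℕ
  | pure _ => 0
  | query x next => (next (f x)).queries f + 1

theorem run_bind (f : X → ℝ) (p : OracleProg X β) (g : β → OracleProg X γ) :
    (p.bind g).run f = (g (p.run f)).run f := by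
  induction p with
  | pure b => rfl
  | query x next ih => exact ih (f x)

end OracleProg

/-! ### The gradient-based zeroth-order algorithm -/

/-- The `i`-th column of a matrix, as a Euclidean vector. -/
def sketchCol {d ℓ : ℕ} (S : Matrix (Fin d) (Fin ℓ) ℝ) (i : Fin ℓ) : EuclideanSpace ℝ (Fin d) :=
  WithLp.toLp 2 fun j => S j i

/-- The gradient estimator: for each column `s` of `S` (in the order of the list) query the oracle
at `x + α s` and at `x - α s` and add `(f (x + α s) - f (x - α s)) / (2 α) • s` to the
accumulator `g`. -/
def gradProg {d ℓ : ℕ} (α : ℝ) (S : Matrix (Fin d) (Fin ℓ) ℝ) (x : EuclideanSpace ℝ (Fin d)) :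
    List (Fin ℓ) → EuclideanSpace ℝ (Fin d) →
      OracleProg (EuclideanSpace ℝ (Fin d)) (EuclideanSpace ℝ (Fin d))
  | [], g => .pure g
  | i :: is, g =>
    .query (x + α • sketchCol S i) fun a =>
      .query (x - α • sketchCol S i) fun b =>
        gradProg α S x is (g + ((a - b) / (2 * α)) • sketchCol S i)

/-- The algorithm with smoothing parameter `α`, constant step size `η`, initial point `x₀`, and
sketching matrices `S 0, …, S (T - 1)`; its output is the iterate `x_T`. -/
def zooProg {d ℓ : ℕ} (α η : ℝ) (x₀ : EuclideanSpace ℝ (Fin d)) :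
    (T : ℕ) → (Fin T → Matrix (Fin d) (Fin ℓ) ℝ) →
      OracleProg (EuclideanSpace ℝ (Fin d)) (EuclideanSpace ℝ (Fin d))
  | 0, _ => .pure x₀
  | T + 1, S =>
    (zooProg α η x₀ T fun t => S t.castSucc).bind fun x =>
      (gradProg α (S (Fin.last T)) x (List.finRange ℓ) 0).bind fun g => .pure (x - η • g)

theorem gradProg_run {d ℓ : ℕ} (f : EuclideanSpace ℝ (Fin d) → ℝ) (α : ℝ)
    (S : Matrix (Fin d) (Fin ℓ) ℝ) (x : EuclideanSpace ℝ (Fin d)) (is : List (Fin ℓ))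
    (g : EuclideanSpace ℝ (Fin d)) :
    (gradProg α S x is g).run f = g + (is.map fun i =>
      ((f (x + α • sketchCol S i) - f (x - α • sketchCol S i)) / (2 * α)) • sketchCol S i).sum := by
  induction is generalizing g with
  | nil => simp [gradProg, OracleProg.run]
  | cons i is ih => simp [gradProg, OracleProg.run, ih, add_assoc]

/-- The iterates follow `x_{t+1} = x_t - η g(x_t)`. -/
theorem zooProg_run_succ {d ℓ : ℕ} (f : EuclideanSpace ℝ (Fin d) → ℝ) (α η : ℝ)
    (x₀ : EuclideanSpace ℝ (Fin d)) (T : ℕ) (S : Fin (T + 1) → Matrix (Fin d) (Fin ℓ) ℝ)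
    (x : EuclideanSpace ℝ (Fin d))
    (hx : x = (zooProg α η x₀ T fun t => S t.castSucc).run f) :
    (zooProg α η x₀ (T + 1) S).run f = x - η • ∑ i,
      ((f (x + α • sketchCol (S (Fin.last T)) i) - f (x - α • sketchCol (S (Fin.last T)) i)) /
        (2 * α)) • sketchCol (S (Fin.last T)) i := by
  rw [zooProg, OracleProg.run_bind, ← hx, OracleProg.run_bind, gradProg_run, zero_add,
    ← List.ofFn_eq_map, List.sum_ofFn]
  rfl

/-- The iteration rate `‖A‖₂ / μ + tr(A) / (μ ℓ)`. -/
def zooRate {d : ℕ} (A : Matrix (Fin d) (Fin d) ℝ) (μ : ℝ) (ℓ : ℕ) : ℝ :=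
  specNorm A / μ + A.trace / (μ * ℓ)

end

/-!
The proof has two independent halves.

*Sketching.* Let `S` have i.i.d. centered entries of variance and sub-Gaussian variance proxy `1 / ℓ`,
and let `B` be fixed. In the basis of right singular vectors the columns `b j` of `B` are
orthogonal, so with `n = ‖B‖₂² + ‖B‖_F² / k` at most `O (k)` of them are longer than a small multiple
of `√n`. On the span of the long ones `S` is a near isometry, by a net of `exp (O (k))` points and
Bernstein-type tails for `‖Sᵀ w‖²` at each fixed `w`
(`IsotropicSubgaussian.measure_exists_abs_gt_le`). On the short ones a crude bound
`‖Sᵀ B‖² ≲ n` with a small constant suffices, and it follows from a net in `ℝ^ℓ`, whose size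
`exp (O (ℓ))` is paid for by the tail whatever the number of columns
(`IsotropicSubgaussian.measure_exists_sum_sq_gt_le`). By Cauchy-Schwarz the cross terms are small too
(`IsotropicSubgaussian.measure_not_sketch_le`). All upper tails come from one exponential moment
bound, in which squares are linearized by an auxiliary Gaussian vector (`lintegral_exp_sum_sq_le`).

*Optimization.* On a quadratic the symmetric differences are exact, so the estimator at `x` is
`S (Sᵀ ∇φ(x) + ξ)` with `|ξ i| ≤ σ / α`. If `q ↦ (S q)ᵀ A (S q)` is at most `η⁻¹ ‖q‖²` and
`‖Sᵀ ∇φ(x)‖² ≥ ‖∇φ(x)‖² / 4`, then completing the square gives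
`φ(x⁺) ≤ φ(x) - (η / 2) ‖Sᵀ ∇φ(x)‖² + (η / 2) ‖ξ‖²`, and strong convexity turns this into a contraction
by `1 - η μ / 4` up to noise (`IsConvexQuadratic.zooStep_sub_le`). The failure probability `δ / T` per
step leaves room for a single sketching event. Both conditions follow from the one for a square
root of `τ A + u uᵀ`, where `u` is the normalized gradient and `τ = (‖A‖₂ + tr A / k)⁻¹`
(`IsObliviousSketch.le_measureReal_curvature_and_gradient`). Since `S_t` is independent of `x_t`, the
union bound over the steps is conditional on `x_t`, by Fubini (`measure_zooProg_gap_gt_le`).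
-/

/-! ### Exponential moments of squares -/

/-- Tonelli's theorem for a product of functions of independent coordinates. -/
theorem lintegral_pi_prod {ι : Type*} [Fintype ι] {X : ι → Type*} [∀ i, MeasurableSpace (X i)]
    (μ : ∀ i, Measure (X i)) [∀ i, IsProbabilityMeasure (μ i)] {F : ∀ i, X i → ℝ≥0∞}
    (hF : ∀ i, Measurable (F i)) :
    ∫⁻ x, ∏ i, F i (x i) ∂Measure.pi μ = ∏ i, ∫⁻ x, F i x ∂μ i := by
  have h := lintegral_prod_eq_prod_lintegral_of_indepFun (μ := Measure.pi μ) Finset.univ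
    (fun i x => F i (x i)) (iIndepFun_pi fun i => (hF i).aemeasurable)
    fun i => (hF i).comp (measurable_pi_apply i)
  rw [h]
  exact Finset.prod_congr rfl fun i _ => (measurePreserving_eval μ i).lintegral_comp (hF i)

/-- Markov's inequality for an exponential. -/
theorem measure_le_of_lintegral_exp_le {Ω : Type*} [MeasurableSpace Ω] {P : Measure Ω}
    {g : Ω → ℝ} (hg : Measurable g) {c : ℝ}
    (h : ∫⁻ x, ENNReal.ofReal (Real.exp (g x)) ∂P ≤ ENNReal.ofReal (Real.exp c)) (a : ℝ) :
    P {x | a ≤ g x} ≤ ENNReal.ofReal (Real.exp (c - a)) := by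
  have hm : Measurable fun x => ENNReal.ofReal (Real.exp (g x)) := by fun_prop
  have h1 := (mul_meas_ge_le_lintegral (μ := P) hm (ENNReal.ofReal (Real.exp a))).trans h
  have hs : {x | ENNReal.ofReal (Real.exp a) ≤ ENNReal.ofReal (Real.exp (g x))} =
      {x | a ≤ g x} := by
    ext x
    simp [ENNReal.ofReal_le_ofReal_iff (Real.exp_pos _).le]
  rw [hs] at h1
  have hpos : 0 < Real.exp a := Real.exp_pos a
  rw [Real.exp_sub, ENNReal.ofReal_div_of_pos hpos, ENNReal.le_div_iff_mul_le
    (Or.inl (by simpa using hpos)) (Or.inl (by simp)), mul_comm]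
  exact h1

theorem lintegral_exp_mul_gaussian (s : ℝ) :
    ∫⁻ g, ENNReal.ofReal (Real.exp (s * g)) ∂gaussianReal 0 1 =
      ENNReal.ofReal (Real.exp (s ^ 2 / 2)) := by
  rw [← ofReal_integral_eq_lintegral_ofReal (integrable_exp_mul_gaussianReal s)
    (Filter.Eventually.of_forall fun _ => (Real.exp_pos _).le)]
  have := congrFun (mgf_fun_id_gaussianReal (μ := 0) (v := 1)) s
  simp only [mgf] at this
  rw [this]
  simp

/-- The value is `(1 - x) ^ (-1 / 2)`; only the exponential bound is needed. -/
theorem lintegral_exp_sq_gaussian_le {x : ℝ} (h0 : 0 ≤ x) (h1 : x ≤ 1 / 2) :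
    ∫⁻ g, ENNReal.ofReal (Real.exp (x * g ^ 2 / 2)) ∂gaussianReal 0 1 ≤
      ENNReal.ofReal (Real.exp (x / 2 + x ^ 2 / 2)) := by
  rw [gaussianReal_of_var_ne_zero 0 one_ne_zero,
    lintegral_withDensity_eq_lintegral_mul _ (measurable_gaussianPDF 0 1) (by fun_prop)]
  have hpos : 0 < (1 - x) / 2 := by linarith
  have hc : 0 < Real.sqrt (2 * Real.pi) := by positivity
  have heq : ∀ g : ℝ, (gaussianPDF 0 1 * fun g => ENNReal.ofReal (Real.exp (x * g ^ 2 / 2))) g =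
      ENNReal.ofReal ((Real.sqrt (2 * Real.pi))⁻¹ * Real.exp (-((1 - x) / 2) * g ^ 2)) := by
    intro g
    simp only [Pi.mul_apply, gaussianPDF, gaussianPDFReal]
    rw [← ENNReal.ofReal_mul (by positivity), mul_assoc, ← Real.exp_add]
    simp only [NNReal.coe_one, mul_one, sub_zero]
    ring_nf
  simp_rw [heq]
  rw [← ofReal_integral_eq_lintegral_ofReal ((integrable_exp_neg_mul_sq hpos).const_mul _)
    (Filter.Eventually.of_forall fun _ => by positivity)]
  refine ENNReal.ofReal_le_ofReal ?_
  rw [integral_const_mul, integral_gaussian]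
  have h2 : (Real.sqrt (2 * Real.pi))⁻¹ * Real.sqrt (Real.pi / ((1 - x) / 2)) =
      Real.sqrt ((1 - x)⁻¹) := by
    rw [← Real.sqrt_inv, ← Real.sqrt_mul (by positivity)]
    congr 1
    have : (1 - x) ≠ 0 := by linarith
    field_simp
  rw [h2]
  -- `1 / (1 - x) ≤ 1 + x + 2 x² ≤ exp (x + x²)` for `0 ≤ x ≤ 1 / 2`
  have h3 : (1 - x)⁻¹ ≤ Real.exp (x + x ^ 2) := by
    rw [inv_le_comm₀ (by linarith) (Real.exp_pos _), ← Real.exp_neg]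
    have h6 : 1 + (x + x ^ 2) + (x + x ^ 2) ^ 2 / 2 ≤ Real.exp (x + x ^ 2) :=
      Real.quadratic_le_exp_of_nonneg (by positivity)
    rw [Real.exp_neg, inv_le_comm₀ (Real.exp_pos _) (by linarith)]
    refine le_trans ?_ h6
    rw [inv_le_iff_one_le_mul₀ (by linarith)]
    nlinarith [mul_nonneg h0 h0, mul_nonneg (mul_nonneg h0 h0) h0,
      mul_nonneg (mul_nonneg (mul_nonneg h0 h0) h0) h0,
      mul_nonneg (mul_nonneg h0 h0) (sub_nonneg.2 h1)]
  calc Real.sqrt ((1 - x)⁻¹) ≤ Real.sqrt (Real.exp (x + x ^ 2)) := Real.sqrt_le_sqrt h3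
    _ = Real.exp (x / 2 + x ^ 2 / 2) := by
      rw [Real.sqrt_eq_iff_mul_self_eq (Real.exp_pos _).le (Real.exp_pos _).le, ← Real.exp_add]
      ring_nf

/-- If a random vector `z` has a sub-Gaussian joint moment generating function with variance
proxies `v j`, then so does the sum of squares, in the range `l * v j ≤ 1 / 2`. The square is
linearized by an auxiliary standard Gaussian vector. -/
theorem lintegral_exp_sum_sq_le {Ω ι : Type*} [Fintype ι] [MeasurableSpace Ω] {P : Measure Ω}
    [IsProbabilityMeasure P] {z : ι → Ω → ℝ} (hz : ∀ j, Measurable (z j)) {v : ι → ℝ}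
    (hv : ∀ j, 0 ≤ v j)
    (hmgf : ∀ t : ι → ℝ, ∫⁻ x, ENNReal.ofReal (Real.exp (∑ j, t j * z j x)) ∂P ≤
      ENNReal.ofReal (Real.exp (∑ j, t j ^ 2 * v j / 2)))
    {l : ℝ} (hl : 0 ≤ l) (hlv : ∀ j, l * v j ≤ 1 / 2) :
    ∫⁻ x, ENNReal.ofReal (Real.exp (∑ j, l * z j x ^ 2 / 2)) ∂P ≤
      ENNReal.ofReal (Real.exp (∑ j, (l * v j / 2 + (l * v j) ^ 2 / 2))) := by
  have hexp : ∀ a : ι → ℝ, ENNReal.ofReal (Real.exp (∑ j, a j)) =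
      ∏ j, ENNReal.ofReal (Real.exp (a j)) := fun a => by
    rw [Real.exp_sum, ENNReal.ofReal_prod_of_nonneg fun _ _ => (Real.exp_pos _).le]
  -- `exp (l z² / 2) = 𝔼 exp (√l g z)` for a standard Gaussian `g`
  have hlin : ∀ x, ENNReal.ofReal (Real.exp (∑ j, l * z j x ^ 2 / 2)) =
      ∫⁻ g : ι → ℝ, ENNReal.ofReal (Real.exp (∑ j, (Real.sqrt l * g j) * z j x))
        ∂Measure.pi fun _ => gaussianReal 0 1 := by
    intro x
    simp_rw [hexp]
    rw [lintegral_pi_prod (fun _ : ι => gaussianReal 0 1)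
      (F := fun j g => ENNReal.ofReal (Real.exp ((Real.sqrt l * g) * z j x))) (by fun_prop)]
    refine Finset.prod_congr rfl fun j _ => ?_
    have := lintegral_exp_mul_gaussian (Real.sqrt l * z j x)
    rw [mul_pow, Real.sq_sqrt hl] at this
    rw [← this]
    refine lintegral_congr fun g => ?_
    ring_nf
  simp_rw [hlin]
  rw [lintegral_lintegral_swap (by fun_prop)]
  calc ∫⁻ g : ι → ℝ, ∫⁻ x, ENNReal.ofReal (Real.exp (∑ j, (Real.sqrt l * g j) * z j x)) ∂P
        ∂Measure.pi (fun _ => gaussianReal 0 1)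
      ≤ ∫⁻ g : ι → ℝ, ∏ j, ENNReal.ofReal (Real.exp ((l * v j) * g j ^ 2 / 2))
        ∂Measure.pi (fun _ => gaussianReal 0 1) := by
        refine lintegral_mono fun g => (hmgf fun j => Real.sqrt l * g j).trans (le_of_eq ?_)
        rw [hexp]
        refine Finset.prod_congr rfl fun j _ => ?_
        rw [mul_pow, Real.sq_sqrt hl]
        ring_nf
    _ = ∏ j, ∫⁻ g, ENNReal.ofReal (Real.exp ((l * v j) * g ^ 2 / 2)) ∂gaussianReal 0 1 :=
        lintegral_pi_prod (fun _ : ι => gaussianReal 0 1)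
          (F := fun j g => ENNReal.ofReal (Real.exp ((l * v j) * g ^ 2 / 2))) (by fun_prop)
    _ ≤ _ := by
        rw [hexp]
        exact Finset.prod_le_prod' fun j _ =>
          lintegral_exp_sq_gaussian_le (mul_nonneg hl (hv j)) (hlv j)

section

open Matrix

/-! ### Isotropic sub-Gaussian vectors -/

/-- The law `κ` of a random vector in `ℝ^d` is sub-Gaussian with variance proxy `v` in every
direction, and its second moment matrix is exactly `v` times the identity. -/
structure IsotropicSubgaussian {d : ℕ} (κ : Measure (Fin d → ℝ)) (v : ℝ) : Prop where
  integrable_exp : ∀ w, Integrable (fun y => Real.exp (w ⬝ᵥ y)) κ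
  integral_exp_le : ∀ w, ∫ y, Real.exp (w ⬝ᵥ y) ∂κ ≤ Real.exp (v * (w ⬝ᵥ w) / 2)
  integral_sq : ∀ w, ∫ y, (w ⬝ᵥ y) ^ 2 ∂κ = v * (w ⬝ᵥ w)

theorem measurable_dotProduct_right {d : ℕ} (w : Fin d → ℝ) :
    Measurable fun y : Fin d → ℝ => w ⬝ᵥ y := by
  unfold dotProduct; fun_prop

/-- Vectors with i.i.d. centered coordinates whose variance equals their sub-Gaussian variance proxy
are isotropic sub-Gaussian. -/
theorem isotropicSubgaussian_pi {d : ℕ} {ρ : Measure ℝ} [IsProbabilityMeasure ρ] {v : ℝ≥0}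
    (hs : HasSubgaussianMGF id v ρ) (hm : ∫ x, x ∂ρ = 0) (hv : ∫ x, x ^ 2 ∂ρ = v) :
    IsotropicSubgaussian (Measure.pi fun _ : Fin d => ρ) v where
  integrable_exp w := by
    simp only [dotProduct, Real.exp_sum]
    exact Integrable.fintype_prod (f := fun j x => Real.exp (w j * x))
      fun j => hs.integrable_exp_mul (w j)
  integral_exp_le w := by
    simp only [dotProduct, Real.exp_sum]
    rw [integral_fintype_prod_eq_prod (fun j x => Real.exp (w j * x)), mul_div_assoc,
      Finset.sum_div, Finset.mul_sum, Real.exp_sum]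
    refine Finset.prod_le_prod (fun j _ => integral_nonneg fun _ => (Real.exp_pos _).le)
      fun j _ => (hs.mgf_le (w j)).trans (le_of_eq ?_)
    ring_nf
  integral_sq w := by
    have hL : MemLp (id : ℝ → ℝ) 2 ρ := by simpa using hs.memLp 2
    have hi : Integrable (id : ℝ → ℝ) ρ := hs.integrable
    have hvar := variance_sum_pi (μ := fun _ : Fin d => ρ) (X := fun j x => w j * x)
      fun j => hL.const_mul (w j)
    have hint : ∫ y : Fin d → ℝ, (∑ j, fun y : Fin d → ℝ => w j * y j) y
        ∂(Measure.pi fun _ => ρ) = 0 := by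
      simp only [Finset.sum_apply]
      rw [integral_finsetSum]
      · refine Finset.sum_eq_zero fun j _ => ?_
        have := integral_comp_eval (μ := fun _ : Fin d => ρ) (i := j)
          (f := fun x => w j * x) (by fun_prop)
        rw [this, integral_const_mul, hm, mul_zero]
      · intro j _
        exact integrable_comp_eval (μ := fun _ : Fin d => ρ) (i := j)
          (f := fun x => w j * x) (hi.const_mul _)
    rw [variance_of_integral_eq_zero (by fun_prop) hint] at hvar
    have h1 : ∀ j, Var[fun x => w j * x; ρ] = v * (w j * w j) := fun j => by
      rw [variance_const_mul, variance_of_integral_eq_zero (by fun_prop) hm, hv]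
      ring
    simp_rw [h1, ← Finset.mul_sum] at hvar
    simpa [dotProduct] using hvar

theorem pow_four_mul_le_exp (s x : ℝ) : s ^ 4 * x ^ 4 ≤ 24 * (Real.exp (s * x) + Real.exp (-s * x)) := by
  have h1 := Real.pow_div_factorial_le_exp |s * x| (abs_nonneg _) 4
  have h2 : Real.exp |s * x| ≤ Real.exp (s * x) + Real.exp (-s * x) := by
    rcases abs_cases (s * x) with h | h <;> rw [h.1]
    · linarith [Real.exp_pos (-s * x)]
    · rw [← neg_mul]; linarith [Real.exp_pos (s * x)]
  have h3 : |s * x| ^ 4 = s ^ 4 * x ^ 4 := by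
    rw [← mul_pow]; exact Even.pow_abs (by decide) _
  have h4 : ((4 : ℕ).factorial : ℝ) = 24 := by norm_num [Nat.factorial]
  rw [h3, h4, div_le_iff₀ (by norm_num)] at h1
  linarith

theorem exp_neg_le_quadratic {x : ℝ} (hx : 0 ≤ x) : Real.exp (-x) ≤ 1 - x + x ^ 2 / 2 := by
  have h1 := Real.quadratic_le_exp_of_nonneg hx
  have h2 : 0 < 1 - x + x ^ 2 / 2 := by nlinarith [sq_nonneg (x - 1)]
  rw [Real.exp_neg, inv_le_iff_one_le_mul₀ (Real.exp_pos _)]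
  nlinarith [mul_le_mul_of_nonneg_left h1 h2.le, pow_nonneg hx 4]

namespace IsotropicSubgaussian

variable {d : ℕ} {κ : Measure (Fin d → ℝ)} {v : ℝ}

theorem lintegral_exp_le (h : IsotropicSubgaussian κ v) (w : Fin d → ℝ) :
    ∫⁻ y, ENNReal.ofReal (Real.exp (w ⬝ᵥ y)) ∂κ ≤
      ENNReal.ofReal (Real.exp (v * (w ⬝ᵥ w) / 2)) := by
  rw [← ofReal_integral_eq_lintegral_ofReal (h.integrable_exp w)
    (Filter.Eventually.of_forall fun _ => (Real.exp_pos _).le)]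
  exact ENNReal.ofReal_le_ofReal (h.integral_exp_le w)

theorem integrable_pow_four (h : IsotropicSubgaussian κ v) (w : Fin d → ℝ) :
    Integrable (fun y => (w ⬝ᵥ y) ^ 4) κ := by
  have hd : Integrable (fun y => 24 * (Real.exp (w ⬝ᵥ y) + Real.exp ((-w) ⬝ᵥ y))) κ :=
    ((h.integrable_exp w).add (h.integrable_exp (-w))).const_mul 24
  refine hd.mono' ((measurable_dotProduct_right w).pow_const 4).aestronglyMeasurable
    (Filter.Eventually.of_forall fun y => ?_)
  rw [Real.norm_eq_abs, abs_of_nonneg (by positivity)]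
  simpa using pow_four_mul_le_exp 1 (w ⬝ᵥ y)

theorem integral_pow_four_le (h : IsotropicSubgaussian κ v) (hv : 0 < v) {w : Fin d → ℝ}
    (hw : w ⬝ᵥ w = 1) : ∫ y, (w ⬝ᵥ y) ^ 4 ∂κ ≤ 48 * v ^ 2 := by
  -- scale so that the exponential moments are at most `exp 1`
  obtain ⟨s, hs⟩ : ∃ s : ℝ, s = Real.sqrt (2 / v) := ⟨_, rfl⟩
  have hs2 : s ^ 2 = 2 / v := by rw [hs, Real.sq_sqrt (by positivity)]
  have hs4 : s ^ 4 = 4 / v ^ 2 := by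
    rw [show s ^ 4 = (s ^ 2) ^ 2 by ring, hs2, div_pow]; norm_num
  have hb : ∀ r : ℝ, r ^ 2 = 2 / v → ∫ y, Real.exp ((r • w) ⬝ᵥ y) ∂κ ≤ Real.exp 1 := by
    intro r hr
    refine (h.integral_exp_le _).trans (Real.exp_le_exp.2 (le_of_eq ?_))
    rw [smul_dotProduct, dotProduct_smul, hw]
    simp only [smul_eq_mul, mul_one]
    rw [← sq, hr]
    field_simp
  have h1 : ∫ y, s ^ 4 * (w ⬝ᵥ y) ^ 4 ∂κ ≤
      ∫ y, 24 * (Real.exp ((s • w) ⬝ᵥ y) + Real.exp ((-s • w) ⬝ᵥ y)) ∂κ := by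
    refine integral_mono ((h.integrable_pow_four w).const_mul _)
      (((h.integrable_exp _).add (h.integrable_exp _)).const_mul 24) fun y => ?_
    have := pow_four_mul_le_exp s (w ⬝ᵥ y)
    simpa [smul_dotProduct, neg_dotProduct] using this
  rw [integral_const_mul, integral_const_mul, integral_add (h.integrable_exp _)
    (h.integrable_exp _), hs4] at h1
  have h2 := hb s hs2
  have h3 := hb (-s) (by rw [neg_sq, hs2])
  have h4 : Real.exp 1 ≤ 4 := by linarith [Real.exp_one_lt_d9]
  rw [div_mul_eq_mul_div, div_le_iff₀ (by positivity)] at h1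
  nlinarith [sq_nonneg v]

/-- For the lower tail the variance has to be exact, since the square enters with its mean to first
order. -/
theorem lintegral_exp_neg_sq_le [IsProbabilityMeasure κ] (h : IsotropicSubgaussian κ v)
    (hv : 0 < v) {w : Fin d → ℝ} (hw : w ⬝ᵥ w = 1) {l : ℝ} (hl : 0 ≤ l) :
    ∫⁻ y, ENNReal.ofReal (Real.exp (-(l * (w ⬝ᵥ y) ^ 2))) ∂κ ≤
      ENNReal.ofReal (Real.exp (-(l * v) + 24 * (l * v) ^ 2)) := by
  have hz := measurable_dotProduct_right w
  have hi2 : Integrable (fun y => (w ⬝ᵥ y) ^ 2) κ := by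
    refine ((integrable_const (1 : ℝ)).add (h.integrable_pow_four w)).mono'
      (hz.pow_const 2).aestronglyMeasurable (Filter.Eventually.of_forall fun y => ?_)
    rw [Real.norm_eq_abs, abs_of_nonneg (by positivity)]
    simp only [Pi.add_apply]
    nlinarith [sq_nonneg ((w ⬝ᵥ y) ^ 2 - 1), sq_nonneg ((w ⬝ᵥ y) ^ 2)]
  have hle : ∀ y, Real.exp (-(l * (w ⬝ᵥ y) ^ 2)) ≤
      1 - l * (w ⬝ᵥ y) ^ 2 + l ^ 2 / 2 * (w ⬝ᵥ y) ^ 4 := by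
    intro y
    have := exp_neg_le_quadratic (x := l * (w ⬝ᵥ y) ^ 2) (by positivity)
    refine this.trans (le_of_eq (by ring))
  have hdom : Integrable (fun y => 1 - l * (w ⬝ᵥ y) ^ 2 + l ^ 2 / 2 * (w ⬝ᵥ y) ^ 4) κ :=
    ((integrable_const (1 : ℝ)).sub (hi2.const_mul l)).add
      ((h.integrable_pow_four w).const_mul _)
  calc ∫⁻ y, ENNReal.ofReal (Real.exp (-(l * (w ⬝ᵥ y) ^ 2))) ∂κ
      ≤ ∫⁻ y, ENNReal.ofReal (1 - l * (w ⬝ᵥ y) ^ 2 + l ^ 2 / 2 * (w ⬝ᵥ y) ^ 4) ∂κ :=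
        lintegral_mono fun y => ENNReal.ofReal_le_ofReal (hle y)
    _ = ENNReal.ofReal (∫ y, (1 - l * (w ⬝ᵥ y) ^ 2 + l ^ 2 / 2 * (w ⬝ᵥ y) ^ 4) ∂κ) :=
        (ofReal_integral_eq_lintegral_ofReal hdom (Filter.Eventually.of_forall fun y =>
          (Real.exp_pos _).le.trans (hle y))).symm
    _ ≤ _ := ENNReal.ofReal_le_ofReal ?_
  rw [integral_add (f := fun y => 1 - l * (w ⬝ᵥ y) ^ 2)
      ((integrable_const (1 : ℝ)).sub (hi2.const_mul l)) ((h.integrable_pow_four w).const_mul _),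
    integral_sub (integrable_const (1 : ℝ)) (hi2.const_mul l), integral_const_mul,
    integral_const_mul, h.integral_sq, hw]
  simp only [integral_const, probReal_univ, smul_eq_mul, mul_one]
  have h4 := mul_le_mul_of_nonneg_left (h.integral_pow_four_le hv hw)
    (by positivity : 0 ≤ l ^ 2 / 2)
  have := Real.add_one_le_exp (-(l * v) + 24 * (l * v) ^ 2)
  nlinarith

end IsotropicSubgaussian

/-! ### Tail bounds for a fixed direction -/

theorem ofReal_exp_sum {ι : Type*} (s : Finset ι) (a : ι → ℝ) :
    ENNReal.ofReal (Real.exp (∑ j ∈ s, a j)) = ∏ j ∈ s, ENNReal.ofReal (Real.exp (a j)) := by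
  rw [Real.exp_sum, ENNReal.ofReal_prod_of_nonneg fun _ _ => (Real.exp_pos _).le]

/-- Pythagoras. -/
theorem dotProduct_self_sum_smul {d : ℕ} {ι : Type*} [Fintype ι] {b : ι → Fin d → ℝ}
    (hb : ∀ j j', j ≠ j' → b j ⬝ᵥ b j' = 0) (t : ι → ℝ) :
    (∑ j, t j • b j) ⬝ᵥ (∑ j, t j • b j) = ∑ j, t j ^ 2 * (b j ⬝ᵥ b j) := by
  rw [sum_dotProduct]
  refine Finset.sum_congr rfl fun j _ => ?_
  rw [dotProduct_sum, Finset.sum_eq_single j]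
  · simp only [smul_dotProduct, dotProduct_smul, smul_eq_mul]; ring
  · intro j' _ hj
    simp [smul_dotProduct, dotProduct_smul, hb j j' hj.symm]
  · simp

namespace IsotropicSubgaussian

variable {d ℓ : ℕ} {κ : Measure (Fin d → ℝ)} [IsProbabilityMeasure κ] {v : ℝ}

theorem lintegral_exp_sum_le (h : IsotropicSubgaussian κ v) (t : Fin ℓ → Fin d → ℝ) :
    ∫⁻ y, ENNReal.ofReal (Real.exp (∑ i, t i ⬝ᵥ y i)) ∂Measure.pi (fun _ : Fin ℓ => κ) ≤
      ENNReal.ofReal (Real.exp (∑ i, v * (t i ⬝ᵥ t i) / 2)) := by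
  simp_rw [ofReal_exp_sum]
  rw [lintegral_pi_prod (fun _ : Fin ℓ => κ)
    (F := fun i y => ENNReal.ofReal (Real.exp (t i ⬝ᵥ y)))
    fun i => ((measurable_dotProduct_right (t i)).exp).ennreal_ofReal]
  exact Finset.prod_le_prod' fun i _ => h.lintegral_exp_le (t i)

/-- Upper tail of the squared length of a unit vector; the columns `y i` carry the scaling
`1 / √ℓ`. -/
theorem measure_sum_sq_ge_le (h : IsotropicSubgaussian κ (ℓ : ℝ)⁻¹) (hℓ : 0 < ℓ)
    {w : Fin d → ℝ} (hw : w ⬝ᵥ w = 1) {γ : ℝ} (h0 : 0 ≤ γ) (h1 : γ ≤ 1) :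
    Measure.pi (fun _ : Fin ℓ => κ) {y | 1 + γ ≤ ∑ i, (w ⬝ᵥ y i) ^ 2} ≤
      ENNReal.ofReal (Real.exp (-(γ ^ 2 * ℓ / 96))) := by
  have hℓ' : (0 : ℝ) < ℓ := by exact_mod_cast hℓ
  have hz : ∀ i : Fin ℓ, Measurable fun y : Fin ℓ → Fin d → ℝ => w ⬝ᵥ y i :=
    fun i => (measurable_dotProduct_right w).comp (measurable_pi_apply i)
  have hm := lintegral_exp_sum_sq_le (P := Measure.pi fun _ : Fin ℓ => κ) (ι := Fin ℓ)
    (z := fun i y => w ⬝ᵥ y i) hz (v := fun _ => (ℓ : ℝ)⁻¹) (fun _ => by positivity)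
    (fun t => by
      have := h.lintegral_exp_sum_le (ℓ := ℓ) fun i => t i • w
      refine (le_of_eq ?_).trans (this.trans (le_of_eq ?_))
      · simp only [smul_dotProduct, smul_eq_mul]
      · simp only [smul_dotProduct, dotProduct_smul, hw, smul_eq_mul, mul_one]
        congr 2
        exact Finset.sum_congr rfl fun i _ => by ring)
    (l := γ * ℓ / 2) (by positivity) (fun _ => by field_simp; linarith)
  have := measure_le_of_lintegral_exp_le (by fun_prop) hm (γ * ℓ / 4 * (1 + γ))
  refine (measure_mono fun y hy => ?_).trans (this.trans (ENNReal.ofReal_le_ofReal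
    (Real.exp_le_exp.2 ?_)))
  · simp only [Set.mem_ofPred_eq] at hy ⊢
    rw [← Finset.sum_div, ← Finset.mul_sum]
    nlinarith [mul_nonneg h0 hℓ'.le]
  · simp only [Finset.sum_const, Finset.card_univ, Fintype.card_fin, nsmul_eq_mul]
    have : (ℓ : ℝ) * (γ * ℓ / 2 * (ℓ : ℝ)⁻¹ / 2 + (γ * ℓ / 2 * (ℓ : ℝ)⁻¹) ^ 2 / 2) =
      γ * ℓ / 4 + γ ^ 2 * ℓ / 8 := by field_simp; ring
    rw [this]
    nlinarith [mul_nonneg (sq_nonneg γ) hℓ'.le]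

/-- Lower tail of the squared length of a unit vector. -/
theorem measure_sum_sq_le_le (h : IsotropicSubgaussian κ (ℓ : ℝ)⁻¹) (hℓ : 0 < ℓ)
    {w : Fin d → ℝ} (hw : w ⬝ᵥ w = 1) {γ : ℝ} (h0 : 0 ≤ γ) :
    Measure.pi (fun _ : Fin ℓ => κ) {y | ∑ i, (w ⬝ᵥ y i) ^ 2 ≤ 1 - γ} ≤
      ENNReal.ofReal (Real.exp (-(γ ^ 2 * ℓ / 96))) := by
  have hℓ' : (0 : ℝ) < ℓ := by exact_mod_cast hℓ
  have hz : ∀ i : Fin ℓ, Measurable fun y : Fin ℓ → Fin d → ℝ => w ⬝ᵥ y i :=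
    fun i => (measurable_dotProduct_right w).comp (measurable_pi_apply i)
  -- the minimizer of `-l γ + 24 l² / ℓ`
  obtain ⟨l, hl⟩ : ∃ l : ℝ, l = γ * ℓ / 48 := ⟨_, rfl⟩
  have hm : ∫⁻ y, ENNReal.ofReal (Real.exp (∑ i, -(l * (w ⬝ᵥ y i) ^ 2)))
      ∂Measure.pi (fun _ : Fin ℓ => κ) ≤
      ENNReal.ofReal (Real.exp (∑ _i : Fin ℓ, (-(l * (ℓ : ℝ)⁻¹) + 24 * (l * (ℓ : ℝ)⁻¹) ^ 2))) := by
    simp_rw [ofReal_exp_sum]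
    rw [lintegral_pi_prod (fun _ : Fin ℓ => κ)
      (F := fun i y => ENNReal.ofReal (Real.exp (-(l * (w ⬝ᵥ y) ^ 2))))
      fun i => (((measurable_dotProduct_right w).pow_const 2).const_mul
        l).neg.exp.ennreal_ofReal]
    exact Finset.prod_le_prod' fun i _ =>
      h.lintegral_exp_neg_sq_le (by positivity) hw (by rw [hl]; positivity)
  have := measure_le_of_lintegral_exp_le (by fun_prop) hm (-(l * (1 - γ)))
  refine (measure_mono fun y hy => ?_).trans (this.trans (ENNReal.ofReal_le_ofReal
    (Real.exp_le_exp.2 ?_)))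
  · simp only [Set.mem_ofPred_eq, Finset.sum_neg_distrib, ← Finset.mul_sum] at hy ⊢
    exact neg_le_neg (mul_le_mul_of_nonneg_left hy (by rw [hl]; positivity))
  · simp only [Finset.sum_const, Finset.card_univ, Fintype.card_fin, nsmul_eq_mul]
    apply le_of_eq
    rw [hl]
    field_simp
    ring

/-- The squared length of a fixed vector is preserved up to a factor `1 ± γ`. -/
theorem measure_abs_sum_sq_sub_gt_le (h : IsotropicSubgaussian κ (ℓ : ℝ)⁻¹) (hℓ : 0 < ℓ)
    (w : Fin d → ℝ) {γ : ℝ} (h0 : 0 ≤ γ) (h1 : γ ≤ 1) :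
    Measure.pi (fun _ : Fin ℓ => κ)
      {y | γ * (w ⬝ᵥ w) < |∑ i, (w ⬝ᵥ y i) ^ 2 - w ⬝ᵥ w|} ≤
      ENNReal.ofReal (2 * Real.exp (-(γ ^ 2 * ℓ / 96))) := by
  rcases eq_or_ne w 0 with rfl | hw
  · simp
  have hq : 0 < w ⬝ᵥ w := by
    have : w ⬝ᵥ w ≠ 0 := fun hz => hw (dotProduct_self_eq_zero.1 hz)
    exact lt_of_le_of_ne (Finset.sum_nonneg fun i _ => mul_self_nonneg _) this.symm
  obtain ⟨r, hr⟩ : ∃ r : ℝ, r = (Real.sqrt (w ⬝ᵥ w))⁻¹ := ⟨_, rfl⟩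
  have hr2 : r ^ 2 * (w ⬝ᵥ w) = 1 := by
    rw [hr, inv_pow, Real.sq_sqrt hq.le, inv_mul_cancel₀ hq.ne']
  have hu : (r • w) ⬝ᵥ (r • w) = 1 := by
    rw [smul_dotProduct, dotProduct_smul, ← hr2]; simp only [smul_eq_mul]; ring
  rw [two_mul, ENNReal.ofReal_add (Real.exp_pos _).le (Real.exp_pos _).le]
  refine (measure_mono fun y hy => ?_).trans ((measure_union_le _ _).trans (add_le_add
    (h.measure_sum_sq_ge_le hℓ hu h0 h1) (h.measure_sum_sq_le_le hℓ hu h0)))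
  have hsum : ∑ i, ((r • w) ⬝ᵥ y i) ^ 2 = r ^ 2 * ∑ i, (w ⬝ᵥ y i) ^ 2 := by
    simp only [smul_dotProduct, smul_eq_mul, mul_pow, Finset.mul_sum]
  simp only [Set.mem_ofPred_eq, Set.mem_union, hsum] at hy ⊢
  have hrp : 0 < r ^ 2 := by
    rcases eq_or_ne r 0 with h0 | h0
    · rw [h0] at hr2; norm_num at hr2
    · positivity
  rcases lt_abs.1 hy with hy | hy
  · left; nlinarith
  · right; nlinarith

/-- For a fixed coefficient vector `a` in the unit ball, the combination `∑ i, a i • y i` of the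
sample has squared coordinates along an orthogonal family `b` of total size `O (s + F / ℓ)`, where
`F` is the sum and `s` a bound of the squared lengths of `b`. -/
theorem measure_sum_sq_orthogonal_ge_le (h : IsotropicSubgaussian κ (ℓ : ℝ)⁻¹) (hℓ : 0 < ℓ)
    {ι : Type*} [Fintype ι] {b : ι → Fin d → ℝ} (hb : ∀ j j', j ≠ j' → b j ⬝ᵥ b j' = 0)
    {s : ℝ} (hs : 0 < s) (hbs : ∀ j, b j ⬝ᵥ b j ≤ s) {a : Fin ℓ → ℝ} (ha : a ⬝ᵥ a ≤ 1) :
    Measure.pi (fun _ : Fin ℓ => κ)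
      {y | 2 * (∑ j, b j ⬝ᵥ b j) / ℓ + 16 * s ≤ ∑ j, (∑ i, a i * (b j ⬝ᵥ y i)) ^ 2} ≤
      ENNReal.ofReal (Real.exp (-(4 * ℓ))) := by
  have hℓ' : (0 : ℝ) < ℓ := by exact_mod_cast hℓ
  have hb0 : ∀ j, 0 ≤ b j ⬝ᵥ b j := fun j => Finset.sum_nonneg fun i _ => mul_self_nonneg _
  have hz : ∀ j, Measurable fun y : Fin ℓ → Fin d → ℝ => ∑ i, a i * (b j ⬝ᵥ y i) :=
    fun j => Finset.measurable_fun_sum _ fun i _ =>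
      ((measurable_dotProduct_right (b j)).comp (measurable_pi_apply i)).const_mul _
  have hm := lintegral_exp_sum_sq_le (P := Measure.pi fun _ : Fin ℓ => κ)
    (z := fun j y => ∑ i, a i * (b j ⬝ᵥ y i)) hz (v := fun j => (ℓ : ℝ)⁻¹ * (b j ⬝ᵥ b j))
    (fun j => mul_nonneg (by positivity) (hb0 j))
    (fun t => by
      have := h.lintegral_exp_sum_le (ℓ := ℓ) fun i => a i • ∑ j, t j • b j
      refine (le_of_eq ?_).trans (this.trans (ENNReal.ofReal_le_ofReal (Real.exp_le_exp.2 ?_)))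
      · refine lintegral_congr fun y => ?_
        congr 2
        simp only [smul_dotProduct, sum_dotProduct, smul_eq_mul, Finset.mul_sum]
        rw [Finset.sum_comm]
        exact Finset.sum_congr rfl fun i _ => Finset.sum_congr rfl fun j _ => by ring
      · have hpyth := dotProduct_self_sum_smul hb t
        have hsum : ∑ i, (ℓ : ℝ)⁻¹ * ((a i • ∑ j, t j • b j) ⬝ᵥ (a i • ∑ j, t j • b j)) / 2 =
            (a ⬝ᵥ a) * ((ℓ : ℝ)⁻¹ * (∑ j, t j ^ 2 * (b j ⬝ᵥ b j)) / 2) := by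
          rw [← hpyth, dotProduct, Finset.sum_mul]
          refine Finset.sum_congr rfl fun i _ => ?_
          simp only [smul_dotProduct, dotProduct_smul, smul_eq_mul]
          ring
        have hnn : 0 ≤ (ℓ : ℝ)⁻¹ * (∑ j, t j ^ 2 * (b j ⬝ᵥ b j)) / 2 :=
          div_nonneg (mul_nonneg (by positivity) (Finset.sum_nonneg fun j _ =>
            mul_nonneg (sq_nonneg _) (hb0 j))) (by norm_num)
        rw [hsum]
        refine (mul_le_of_le_one_left hnn ha).trans (le_of_eq ?_)
        rw [Finset.mul_sum, Finset.sum_div]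
        exact Finset.sum_congr rfl fun j _ => by ring)
    (l := ℓ / (2 * s)) (by positivity) (fun j => by
      have : (ℓ : ℝ) / (2 * s) * ((ℓ : ℝ)⁻¹ * (b j ⬝ᵥ b j)) = (b j ⬝ᵥ b j) / (2 * s) := by
        field_simp
      rw [this, div_le_iff₀ (by positivity)]
      linarith [hbs j])
  have := measure_le_of_lintegral_exp_le (by fun_prop) hm
    ((2 * (∑ j, b j ⬝ᵥ b j) / ℓ + 16 * s) * (ℓ / (4 * s)))
  refine (measure_mono fun y hy => ?_).trans (this.trans (ENNReal.ofReal_le_ofReal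
    (Real.exp_le_exp.2 ?_)))
  · simp only [Set.mem_ofPred_eq] at hy ⊢
    refine (mul_le_mul_of_nonneg_right hy (by positivity)).trans (le_of_eq ?_)
    rw [Finset.sum_mul]
    refine Finset.sum_congr rfl fun j _ => ?_
    field_simp
    ring
  · have h1 : ∑ j, ((ℓ : ℝ) / (2 * s) * ((ℓ : ℝ)⁻¹ * (b j ⬝ᵥ b j)) / 2 +
        ((ℓ : ℝ) / (2 * s) * ((ℓ : ℝ)⁻¹ * (b j ⬝ᵥ b j))) ^ 2 / 2) ≤
        ∑ j, (b j ⬝ᵥ b j) / (2 * s) := by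
      refine Finset.sum_le_sum fun j _ => ?_
      have e : (ℓ : ℝ) / (2 * s) * ((ℓ : ℝ)⁻¹ * (b j ⬝ᵥ b j)) = (b j ⬝ᵥ b j) / (2 * s) := by
        field_simp
      have e1 : (b j ⬝ᵥ b j) / (2 * s) ≤ 1 / 2 := by
        rw [div_le_iff₀ (by positivity)]; linarith [hbs j]
      have e0 : 0 ≤ (b j ⬝ᵥ b j) / (2 * s) := div_nonneg (hb0 j) (by positivity)
      rw [e]
      nlinarith
    have h2 : (2 * (∑ j, b j ⬝ᵥ b j) / ℓ + 16 * s) * (ℓ / (4 * s)) =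
        ∑ j, (b j ⬝ᵥ b j) / (2 * s) + 4 * ℓ := by
      rw [← Finset.sum_div]
      field_simp
      ring
    rw [h2]
    linarith

end IsotropicSubgaussian

/-! ### Operator norms from nets -/

/-- A `1 / 2`-net of the unit ball of cardinality `5 ^ dim`: a maximal separated subset. -/
theorem exists_half_net (E : Type*) [NormedAddCommGroup E] [NormedSpace ℝ E]
    [FiniteDimensional ℝ E] :
    ∃ N : Finset E, N.card ≤ 5 ^ Module.finrank ℝ E ∧ (∀ u ∈ N, ‖u‖ ≤ 1) ∧
      ∀ x : E, ‖x‖ ≤ 1 → ∃ u ∈ N, ‖x - u‖ ≤ 1 / 2 := by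
  classical
  obtain ⟨Q, hQ⟩ : ∃ Q : Finset E → Prop, Q = fun s =>
      (∀ u ∈ s, ‖u‖ ≤ 1) ∧ ∀ u ∈ s, ∀ u' ∈ s, u ≠ u' → 1 / 2 ≤ ‖u - u'‖ := ⟨_, rfl⟩
  have hcard : ∀ s, Q s → s.card ≤ 5 ^ Module.finrank ℝ E := by
    rintro s hs
    rw [hQ] at hs
    have hinj : Function.Injective fun u : E => (2 : ℝ) • u :=
      smul_right_injective E two_ne_zero
    rw [← Finset.card_image_of_injective s hinj]
    refine Besicovitch.card_le_of_separated _ ?_ ?_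
    · simp only [Finset.mem_image, forall_exists_index, and_imp]
      rintro _ u hu rfl
      rw [norm_smul, Real.norm_two]
      linarith [hs.1 u hu]
    · simp only [Finset.mem_image, forall_exists_index, and_imp]
      rintro _ u hu rfl _ u' hu' rfl hne
      rw [← smul_sub, norm_smul, Real.norm_two]
      linarith [hs.2 u hu u' hu' fun h => hne (by rw [h])]
  have hbdd : BddAbove {n | ∃ s, Q s ∧ s.card = n} :=
    ⟨_, by rintro _ ⟨s, hs, rfl⟩; exact hcard s hs⟩
  have hne : {n | ∃ s, Q s ∧ s.card = n}.Nonempty := ⟨0, ∅, by rw [hQ]; simp, by simp⟩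
  obtain ⟨s, hs, hsc⟩ := Nat.sSup_mem hne hbdd
  refine ⟨s, hcard s hs, by rw [hQ] at hs; exact hs.1, fun x hx => ?_⟩
  by_contra! hfar
  have hxs : x ∉ s := fun h => by have := hfar x h; simp at this; linarith
  have hins : Q (insert x s) := by
    rw [hQ] at hs ⊢
    refine ⟨fun u hu => ?_, fun u hu u' hu' hne => ?_⟩
    · rcases Finset.mem_insert.1 hu with rfl | hu
      exacts [hx, hs.1 u hu]
    · rcases Finset.mem_insert.1 hu with h1 | h1 <;>
        rcases Finset.mem_insert.1 hu' with h2 | h2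
      · exact absurd (h1.trans h2.symm) hne
      · rw [h1]; exact (hfar u' h2).le
      · rw [h2, norm_sub_rev]; exact (hfar u h1).le
      · exact hs.2 u h1 u' h2 hne
  have := le_csSup hbdd ⟨_, hins, rfl⟩
  rw [Finset.card_insert_of_notMem hxs, ← hsc] at this
  omega

/-- The error of the net approximation is absorbed, since it is half of the operator norm. -/
theorem norm_le_of_half_net {E F : Type*} [NormedAddCommGroup E] [NormedSpace ℝ E]
    [FiniteDimensional ℝ E] [NormedAddCommGroup F] [NormedSpace ℝ F] {N : Finset E}
    (hN : ∀ x : E, ‖x‖ ≤ 1 → ∃ u ∈ N, ‖x - u‖ ≤ 1 / 2) (L : E →ₗ[ℝ] F) {R : ℝ} (hR : 0 ≤ R)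
    (h : ∀ u ∈ N, ‖L u‖ ≤ R) (x : E) : ‖L x‖ ≤ 2 * R * ‖x‖ := by
  obtain ⟨L', hL'⟩ : ∃ L' : E →L[ℝ] F, L' = LinearMap.toContinuousLinearMap L := ⟨_, rfl⟩
  have hLL : ∀ x, L' x = L x := fun x => by rw [hL']; rfl
  have h1 : ‖L'‖ ≤ R + ‖L'‖ * (1 / 2) := by
    refine ContinuousLinearMap.opNorm_le_of_unit_norm (by positivity) fun z hz => ?_
    obtain ⟨u, hu, hzu⟩ := hN z hz.le
    calc ‖L' z‖ = ‖L' u + L' (z - u)‖ := by rw [← map_add]; congr 2; abel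
      _ ≤ ‖L' u‖ + ‖L' (z - u)‖ := norm_add_le _ _
      _ ≤ R + ‖L'‖ * (1 / 2) := add_le_add (by rw [hLL]; exact h u hu)
        ((L'.le_opNorm _).trans (mul_le_mul_of_nonneg_left hzu (norm_nonneg _)))
  rw [← hLL]
  exact (L'.le_opNorm x).trans (mul_le_mul_of_nonneg_right (by linarith) (norm_nonneg _))

/-- A difference of two squared seminorms is controlled by its values at sums and differences of
net points, by polarization. -/
theorem abs_norm_sq_sub_le_of_half_net {E F G : Type*} [NormedAddCommGroup E] [NormedSpace ℝ E]
    [FiniteDimensional ℝ E] [NormedAddCommGroup F] [InnerProductSpace ℝ F]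
    [NormedAddCommGroup G] [InnerProductSpace ℝ G] {N : Finset E}
    (hN : ∀ x : E, ‖x‖ ≤ 1 → ∃ u ∈ N, ‖x - u‖ ≤ 1 / 2) (L : E →ₗ[ℝ] F) (H : E →ₗ[ℝ] G)
    {K : ℝ} (hK : 0 ≤ K)
    (hadd : ∀ u ∈ N, ∀ u' ∈ N, |‖L (u + u')‖ ^ 2 - ‖H (u + u')‖ ^ 2| ≤ K)
    (hsub : ∀ u ∈ N, ∀ u' ∈ N, |‖L (u - u')‖ ^ 2 - ‖H (u - u')‖ ^ 2| ≤ K) (x : E) :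
    |‖L x‖ ^ 2 - ‖H x‖ ^ 2| ≤ 2 * K * ‖x‖ ^ 2 := by
  let B : E → E →ₗ[ℝ] ℝ := fun x =>
    (innerₗ F (L x)).comp L - (innerₗ G (H x)).comp H
  have hB : ∀ x x', B x x' = inner ℝ (L x) (L x') - inner ℝ (H x) (H x') := fun x x' => rfl
  have hsymm : ∀ x x', B x x' = B x' x := fun x x' => by
    rw [hB, hB, real_inner_comm, real_inner_comm (H x)]
  -- the polar form at net points; it is then extended in one variable at a time
  have hnet : ∀ u ∈ N, ∀ u' ∈ N, ‖B u u'‖ ≤ K / 2 := by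
    intro u hu u' hu'
    have h1 := hadd u hu u' hu'
    have h2 := hsub u hu u' hu'
    rw [map_add, map_add, norm_add_sq_real, norm_add_sq_real] at h1
    rw [map_sub, map_sub, norm_sub_sq_real, norm_sub_sq_real] at h2
    rw [Real.norm_eq_abs, hB, abs_le]
    rw [abs_le] at h1 h2
    constructor <;> linarith
  have h1 : ∀ u ∈ N, ∀ x, ‖B x u‖ ≤ K * ‖x‖ := fun u hu x => by
    rw [hsymm]
    exact (norm_le_of_half_net hN (B u) (by positivity) (hnet u hu) x).trans (le_of_eq (by ring))
  have h2 := norm_le_of_half_net hN (B x) (by positivity) (fun u hu => h1 u hu x) x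
  rw [hB, real_inner_self_eq_norm_sq, real_inner_self_eq_norm_sq, Real.norm_eq_abs] at h2
  exact h2.trans (le_of_eq (by ring))

/-- A bound for a matrix on a net bounds its transpose everywhere. -/
theorem sum_sq_le_of_half_net {ι κ : Type*} [Fintype ι] [Fintype κ] [DecidableEq κ]
    {N : Finset (EuclideanSpace ℝ κ)}
    (hN : ∀ x : EuclideanSpace ℝ κ, ‖x‖ ≤ 1 → ∃ u ∈ N, ‖x - u‖ ≤ 1 / 2) (G : ι → κ → ℝ)
    {R : ℝ} (hR : 0 ≤ R) (h : ∀ u ∈ N, ∑ j, (∑ i, u i * G j i) ^ 2 ≤ R) (c : ι → ℝ) :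
    ∑ i, (∑ j, c j * G j i) ^ 2 ≤ 4 * R * ∑ j, c j ^ 2 := by
  have hL : ∀ x : EuclideanSpace ℝ κ, ‖Matrix.toEuclideanLin (Matrix.of G) x‖ ^ 2 =
      ∑ j, (∑ i, x i * G j i) ^ 2 := fun x => by
    rw [EuclideanSpace.real_norm_sq_eq]
    refine Finset.sum_congr rfl fun j _ => ?_
    simp [Matrix.toLpLin_apply, Matrix.mulVec, dotProduct, mul_comm]
  obtain ⟨a, ha⟩ : ∃ a : κ → ℝ, a = fun i => ∑ j, c j * G j i := ⟨_, rfl⟩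
  have h1 := norm_le_of_half_net hN (Matrix.toEuclideanLin (Matrix.of G)) (Real.sqrt_nonneg R)
    (fun u hu => Real.le_sqrt_of_sq_le ((hL u).trans_le (h u hu))) (WithLp.toLp 2 a)
  have h2 : ∑ j, (∑ i, a i * G j i) ^ 2 ≤ 4 * R * ∑ i, a i ^ 2 := by
    have h3 := pow_le_pow_left₀ (norm_nonneg _) h1 2
    rw [hL, mul_pow, mul_pow, Real.sq_sqrt hR, EuclideanSpace.real_norm_sq_eq] at h3
    exact h3.trans (le_of_eq (by norm_num))
  have h3 : ∑ i, a i ^ 2 = ∑ j, c j * ∑ i, a i * G j i := by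
    simp_rw [Finset.mul_sum]
    rw [Finset.sum_comm]
    refine Finset.sum_congr rfl fun i _ => ?_
    rw [sq]
    nth_rewrite 2 [ha]
    rw [Finset.mul_sum]
    exact Finset.sum_congr rfl fun j _ => by ring
  have h4 := Finset.sum_mul_sq_le_sq_mul_sq Finset.univ c fun j => ∑ i, a i * G j i
  rw [← h3] at h4
  have hc : 0 ≤ ∑ j, c j ^ 2 := Finset.sum_nonneg fun _ _ => sq_nonneg _
  have h5 : (∑ i, a i ^ 2) ^ 2 ≤ (∑ j, c j ^ 2) * (4 * R * ∑ i, a i ^ 2) :=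
    h4.trans (mul_le_mul_of_nonneg_left h2 hc)
  have ha0 : 0 ≤ ∑ i, a i ^ 2 := Finset.sum_nonneg fun _ _ => sq_nonneg _
  have h6 : ∑ i, a i ^ 2 ≤ 4 * R * ∑ j, c j ^ 2 := by
    rcases ha0.eq_or_lt with h0 | h0
    · rw [← h0]; positivity
    · nlinarith
  simpa only [ha] using h6

/-! ### Uniform bounds over orthogonal families -/

/-- The test points of the polarization argument. -/
theorem exists_finset_add_sub {E : Type*} [NormedAddCommGroup E] (N : Finset E) :
    ∃ W : Finset E, W.card ≤ 2 * (N.card * N.card) ∧ (∀ u ∈ N, ∀ u' ∈ N, u + u' ∈ W) ∧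
      (∀ u ∈ N, ∀ u' ∈ N, u - u' ∈ W) ∧ ((∀ u ∈ N, ‖u‖ ≤ 1) → ∀ w ∈ W, ‖w‖ ≤ 2) := by
  classical
  refine ⟨(N ×ˢ N).image (fun p => p.1 + p.2) ∪ (N ×ˢ N).image (fun p => p.1 - p.2), ?_,
    fun u hu u' hu' => Finset.mem_union_left _
      (Finset.mem_image.2 ⟨(u, u'), Finset.mem_product.2 ⟨hu, hu'⟩, rfl⟩),
    fun u hu u' hu' => Finset.mem_union_right _
      (Finset.mem_image.2 ⟨(u, u'), Finset.mem_product.2 ⟨hu, hu'⟩, rfl⟩), fun hN1 w hw => ?_⟩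
  · rw [← Finset.card_product, two_mul]
    exact (Finset.card_union_le _ _).trans (add_le_add Finset.card_image_le Finset.card_image_le)
  · rcases Finset.mem_union.1 hw with hw | hw <;>
      obtain ⟨p, hp, rfl⟩ := Finset.mem_image.1 hw <;>
      have hp1 := hN1 _ (Finset.mem_product.1 hp).1 <;>
      have hp2 := hN1 _ (Finset.mem_product.1 hp).2
    · linarith [norm_add_le p.1 p.2]
    · linarith [norm_sub_le p.1 p.2]

theorem sum_smul_dotProduct_eq {d : ℕ} {ι : Type*} [Fintype ι] (b : ι → Fin d → ℝ) (c : ι → ℝ) (y : Fin d → ℝ) :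
    (∑ j, c j • b j) ⬝ᵥ y = ∑ j, c j * (b j ⬝ᵥ y) := by
  simp [sum_dotProduct, smul_dotProduct]

/-- Perturbing `a` by a much smaller `e`, with weights `1 / 16` and `16` in the cross term. -/
theorem abs_sum_add_sq_sub_le {ℓ : ℕ} {a e : Fin ℓ → ℝ} {A E : ℝ} (hA : ∑ i, a i ^ 2 ≤ A) (hE : ∑ i, e i ^ 2 ≤ E) :
    |∑ i, (a i + e i) ^ 2 - ∑ i, a i ^ 2| ≤ A / 16 + 17 * E := by
  have h1 : ∑ i, (a i + e i) ^ 2 - ∑ i, a i ^ 2 = ∑ i, (2 * (a i * e i) + e i ^ 2) := by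
    rw [← Finset.sum_sub_distrib]; exact Finset.sum_congr rfl fun i _ => by ring
  rw [h1]
  calc |∑ i, (2 * (a i * e i) + e i ^ 2)| ≤ ∑ i, |2 * (a i * e i) + e i ^ 2| :=
        Finset.abs_sum_le_sum_abs _ _
    _ ≤ ∑ i, (a i ^ 2 / 16 + 17 * e i ^ 2) := by
        refine Finset.sum_le_sum fun i _ => abs_le.2 ⟨?_, ?_⟩ <;>
          nlinarith [sq_nonneg (a i / 4 + 4 * e i), sq_nonneg (a i / 4 - 4 * e i),
            sq_nonneg (e i)]
    _ = (∑ i, a i ^ 2) / 16 + 17 * ∑ i, e i ^ 2 := by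
        rw [Finset.sum_add_distrib, Finset.sum_div, Finset.mul_sum]
    _ ≤ _ := by linarith

namespace IsotropicSubgaussian

variable {d ℓ : ℕ} {κ : Measure (Fin d → ℝ)} [IsProbabilityMeasure κ] {ι : Type*} [Fintype ι]
  {b : ι → Fin d → ℝ}

/-- Few directions: the sample is a near isometry on the span of `b`, with an error probability
that is exponential in the number of directions. -/
theorem measure_exists_abs_gt_le (h : IsotropicSubgaussian κ (ℓ : ℝ)⁻¹) (hℓ : 0 < ℓ)
    (hb : ∀ j j', j ≠ j' → b j ⬝ᵥ b j' = 0) {n : ℝ} (hn : 0 ≤ n) (hbn : ∀ j, b j ⬝ᵥ b j ≤ n)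
    {γ : ℝ} (h0 : 0 ≤ γ) (h1 : γ ≤ 1) :
    Measure.pi (fun _ : Fin ℓ => κ) {y | ¬∀ c : ι → ℝ,
      |∑ i, ((∑ j, c j • b j) ⬝ᵥ y i) ^ 2 - (∑ j, c j • b j) ⬝ᵥ (∑ j, c j • b j)| ≤
        8 * γ * n * ∑ j, c j ^ 2} ≤
      ENNReal.ofReal (4 * 25 ^ Fintype.card ι * Real.exp (-(γ ^ 2 * ℓ / 96))) := by
  classical
  obtain ⟨N, hcard, hN1, hN⟩ := exists_half_net (EuclideanSpace ℝ ι)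
  rw [finrank_euclideanSpace] at hcard
  obtain ⟨W, hWc, hadd, hsub, hWn⟩ := exists_finset_add_sub N
  have hWcard : W.card ≤ 2 * 25 ^ Fintype.card ι := by
    have h2 : N.card * N.card ≤ 25 ^ Fintype.card ι := by
      rw [show 25 = 5 * 5 by norm_num, mul_pow]
      exact Nat.mul_le_mul hcard hcard
    omega
  have hW2 : ∀ w ∈ W, ‖w‖ ≤ 2 := hWn hN1
  let H : EuclideanSpace ℝ ι → Fin d → ℝ := fun w => ∑ j, w j • b j
  have hbad : {y : Fin ℓ → Fin d → ℝ | ¬∀ c : ι → ℝ,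
      |∑ i, ((∑ j, c j • b j) ⬝ᵥ y i) ^ 2 - (∑ j, c j • b j) ⬝ᵥ (∑ j, c j • b j)| ≤
        8 * γ * n * ∑ j, c j ^ 2} ⊆
      ⋃ w ∈ W, {y | γ * (H w ⬝ᵥ H w) < |∑ i, (H w ⬝ᵥ y i) ^ 2 - H w ⬝ᵥ H w|} := by
    intro y hy
    by_contra hcon
    simp only [Set.mem_iUnion, Set.mem_ofPred_eq, exists_prop, not_exists, not_and, not_lt] at hcon
    refine hy fun c => ?_
    let L := Matrix.toEuclideanLin (Matrix.of fun (i : Fin ℓ) (j : ι) => b j ⬝ᵥ y i)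
    let M := Matrix.toEuclideanLin (Matrix.of fun (m : Fin d) (j : ι) => b j m)
    have hL : ∀ w : EuclideanSpace ℝ ι, ‖L w‖ ^ 2 = ∑ i, (H w ⬝ᵥ y i) ^ 2 := fun w => by
      rw [EuclideanSpace.real_norm_sq_eq]
      refine Finset.sum_congr rfl fun i _ => ?_
      simp only [H, sum_smul_dotProduct_eq]
      simp [L, Matrix.toLpLin_apply, Matrix.mulVec, dotProduct, mul_comm]
    have hM : ∀ w : EuclideanSpace ℝ ι, ‖M w‖ ^ 2 = H w ⬝ᵥ H w := fun w => by
      rw [EuclideanSpace.real_norm_sq_eq]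
      refine Finset.sum_congr rfl fun i _ => ?_
      simp [H, M, Matrix.toLpLin_apply, Matrix.mulVec, dotProduct, mul_comm, sq]
    have hK : ∀ w ∈ W, |‖L w‖ ^ 2 - ‖M w‖ ^ 2| ≤ 4 * γ * n := fun w hw => by
      rw [hL, hM]
      refine (hcon w hw).trans ?_
      have h3 : H w ⬝ᵥ H w ≤ n * ‖w‖ ^ 2 := by
        simp only [H]
        rw [dotProduct_self_sum_smul hb, EuclideanSpace.real_norm_sq_eq, Finset.mul_sum]
        refine Finset.sum_le_sum fun j _ => ?_
        nlinarith [hbn j, sq_nonneg (w j)]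
      have h4 : ‖w‖ ^ 2 ≤ 4 := by nlinarith [hW2 w hw, norm_nonneg w]
      nlinarith [mul_le_mul_of_nonneg_left h3 h0,
        mul_le_mul_of_nonneg_left h4 (mul_nonneg h0 hn)]
    have := abs_norm_sq_sub_le_of_half_net hN L M (K := 4 * γ * n) (by positivity)
      (fun u hu u' hu' => hK _ (hadd u hu u' hu')) (fun u hu u' hu' => hK _ (hsub u hu u' hu'))
      (WithLp.toLp 2 c)
    rw [hL, hM, EuclideanSpace.real_norm_sq_eq] at this
    exact this.trans (le_of_eq (by ring))
  refine (measure_mono hbad).trans ((measure_biUnion_finset_le _ _).trans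
    ((Finset.sum_le_sum fun w _ => h.measure_abs_sum_sq_sub_gt_le hℓ (H w) h0 h1).trans ?_))
  rw [Finset.sum_const, nsmul_eq_mul, ← ENNReal.ofReal_natCast,
    ← ENNReal.ofReal_mul (Nat.cast_nonneg _)]
  refine ENNReal.ofReal_le_ofReal ?_
  have : (W.card : ℝ) ≤ 2 * 25 ^ Fintype.card ι := by exact_mod_cast hWcard
  nlinarith [Real.exp_pos (-(γ ^ 2 * ℓ / 96))]

/-- Many short directions: a crude upper bound whose error probability is exponential in the
sample size, whatever the number of directions. -/
theorem measure_exists_sum_sq_gt_le (h : IsotropicSubgaussian κ (ℓ : ℝ)⁻¹) (hℓ : 0 < ℓ)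
    (hb : ∀ j j', j ≠ j' → b j ⬝ᵥ b j' = 0) {s : ℝ} (hs : 0 < s) (hbs : ∀ j, b j ⬝ᵥ b j ≤ s) :
    Measure.pi (fun _ : Fin ℓ => κ) {y | ¬∀ c : ι → ℝ,
      ∑ i, ((∑ j, c j • b j) ⬝ᵥ y i) ^ 2 ≤
        4 * (2 * (∑ j, b j ⬝ᵥ b j) / ℓ + 16 * s) * ∑ j, c j ^ 2} ≤
      ENNReal.ofReal (Real.exp (-(2 * ℓ))) := by
  classical
  obtain ⟨N, hcard, hN1, hN⟩ := exists_half_net (EuclideanSpace ℝ (Fin ℓ))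
  rw [finrank_euclideanSpace, Fintype.card_fin] at hcard
  have hR : 0 ≤ 2 * (∑ j, b j ⬝ᵥ b j) / ℓ + 16 * s := by
    have : 0 ≤ ∑ j, b j ⬝ᵥ b j :=
      Finset.sum_nonneg fun j _ => Finset.sum_nonneg fun i _ => mul_self_nonneg _
    positivity
  have hsub : {y : Fin ℓ → Fin d → ℝ | ¬∀ c : ι → ℝ,
      ∑ i, ((∑ j, c j • b j) ⬝ᵥ y i) ^ 2 ≤
        4 * (2 * (∑ j, b j ⬝ᵥ b j) / ℓ + 16 * s) * ∑ j, c j ^ 2} ⊆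
      ⋃ a ∈ N, {y | 2 * (∑ j, b j ⬝ᵥ b j) / ℓ + 16 * s ≤
        ∑ j, (∑ i, a i * (b j ⬝ᵥ y i)) ^ 2} := by
    intro y hy
    by_contra hcon
    simp only [Set.mem_iUnion, Set.mem_ofPred_eq, exists_prop, not_exists, not_and, not_le] at hcon
    refine hy fun c => ?_
    simp only [sum_smul_dotProduct_eq]
    exact sum_sq_le_of_half_net hN (fun j i => b j ⬝ᵥ y i) hR (fun u hu => (hcon u hu).le) c
  have hfix : ∀ a ∈ N, Measure.pi (fun _ : Fin ℓ => κ)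
      {y | 2 * (∑ j, b j ⬝ᵥ b j) / ℓ + 16 * s ≤ ∑ j, (∑ i, a i * (b j ⬝ᵥ y i)) ^ 2} ≤
      ENNReal.ofReal (Real.exp (-(4 * ℓ))) := by
    intro a ha
    have h2 : (a : Fin ℓ → ℝ) ⬝ᵥ a = ‖a‖ ^ 2 := by
      rw [EuclideanSpace.real_norm_sq_eq]
      exact Finset.sum_congr rfl fun i _ => (sq _).symm
    refine h.measure_sum_sq_orthogonal_ge_le hℓ hb hs hbs (a := a) ?_
    rw [h2]
    nlinarith [hN1 a ha, norm_nonneg a]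
  refine (measure_mono hsub).trans ((measure_biUnion_finset_le _ _).trans
    ((Finset.sum_le_sum hfix).trans ?_))
  rw [Finset.sum_const, nsmul_eq_mul, ← ENNReal.ofReal_natCast,
    ← ENNReal.ofReal_mul (Nat.cast_nonneg _)]
  refine ENNReal.ofReal_le_ofReal ?_
  have h5 : (5 : ℝ) ≤ Real.exp 2 := by
    have := Real.exp_one_gt_d9
    rw [show (2 : ℝ) = 1 + 1 by norm_num, Real.exp_add]
    nlinarith
  have h6 : (N.card : ℝ) ≤ Real.exp (2 * ℓ) := by
    calc (N.card : ℝ) ≤ 5 ^ ℓ := by exact_mod_cast hcard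
      _ ≤ Real.exp 2 ^ ℓ := pow_le_pow_left₀ (by norm_num) h5 _
      _ = Real.exp (2 * ℓ) := by rw [← Real.exp_nat_mul, mul_comm]
  calc (N.card : ℝ) * Real.exp (-(4 * ℓ)) ≤ Real.exp (2 * ℓ) * Real.exp (-(4 * ℓ)) :=
        mul_le_mul_of_nonneg_right h6 (Real.exp_pos _).le
    _ = Real.exp (-(2 * ℓ)) := by rw [← Real.exp_add]; ring_nf

/-- The sketching property for an orthogonal family: directions longer than `√(n / 2 ^ 15)` are
few and are handled by a net, the shorter ones only by the crude upper bound. -/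
theorem measure_not_sketch_le (h : IsotropicSubgaussian κ (ℓ : ℝ)⁻¹)
    (hb : ∀ j j', j ≠ j' → b j ⬝ᵥ b j' = 0) {n k δ : ℝ} (hn : 0 < n)
    (hbn : ∀ j, b j ⬝ᵥ b j ≤ n) (hk : 1 ≤ k) (hsum : ∑ j, b j ⬝ᵥ b j ≤ k * n)
    (hδ : 0 < δ) (hδ1 : δ < 1) (hℓ : 10 ^ 12 * (k + Real.log (1 / δ)) ≤ ℓ) :
    Measure.pi (fun _ : Fin ℓ => κ) {y | ¬∀ c : ι → ℝ,
      |∑ i, ((∑ j, c j • b j) ⬝ᵥ y i) ^ 2 - (∑ j, c j • b j) ⬝ᵥ (∑ j, c j • b j)| ≤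
        1 / 4 * n * ∑ j, c j ^ 2} ≤ ENNReal.ofReal δ := by
  classical
  have hlog : 0 < Real.log (1 / δ) := Real.log_pos (by rw [lt_div_iff₀ hδ]; linarith)
  have hℓ' : (0 : ℝ) < ℓ := lt_of_lt_of_le (by positivity) hℓ
  have hℓ0 : 0 < ℓ := by exact_mod_cast hℓ'
  have hb0 : ∀ j, 0 ≤ b j ⬝ᵥ b j := fun j => Finset.sum_nonneg fun i _ => mul_self_nonneg _
  have hexpδ : Real.exp (-Real.log (1 / δ)) = δ := by
    rw [one_div, Real.log_inv, neg_neg, Real.exp_log hδ]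
  have hhalf : Real.exp (-1) ≤ 1 / 2 := by
    rw [Real.exp_neg, one_div]
    exact inv_anti₀ (by norm_num) (by linarith [Real.add_one_le_exp (1 : ℝ)])
  have hδ2 : Real.exp (-Real.log (1 / δ) - 1) ≤ δ / 2 := by
    rw [sub_eq_add_neg, Real.exp_add, hexpδ]
    nlinarith
  -- the long directions; at most `2 ^ 15 * k` of them fit into `∑ j, b j ⬝ᵥ b j ≤ k * n`
  let p : ι → Prop := fun j => n / 2 ^ 15 < b j ⬝ᵥ b j
  let b₁ : {j // p j} → Fin d → ℝ := fun j => b j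
  let b₂ : {j // ¬p j} → Fin d → ℝ := fun j => b j
  have hb₁ : ∀ j j', j ≠ j' → b₁ j ⬝ᵥ b₁ j' = 0 := fun j j' hj =>
    hb _ _ fun h => hj (Subtype.ext h)
  have hb₂ : ∀ j j', j ≠ j' → b₂ j ⬝ᵥ b₂ j' = 0 := fun j j' hj =>
    hb _ _ fun h => hj (Subtype.ext h)
  have hsplit : ∑ j, b₁ j ⬝ᵥ b₁ j + ∑ j, b₂ j ⬝ᵥ b₂ j = ∑ j, b j ⬝ᵥ b j :=
    Fintype.sum_subtype_add_sum_subtype p fun j => b j ⬝ᵥ b j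
  have hcard : (Fintype.card {j // p j} : ℝ) ≤ 32768 * k := by
    have h1 : (Fintype.card {j // p j} : ℝ) * (n / 2 ^ 15) ≤ ∑ j, b₁ j ⬝ᵥ b₁ j := by
      rw [← nsmul_eq_mul, ← Finset.card_univ, ← Finset.sum_const]
      exact Finset.sum_le_sum fun j _ => j.2.le
    have h2 : 0 ≤ ∑ j, b₂ j ⬝ᵥ b₂ j := Finset.sum_nonneg fun j _ => hb0 j
    have h3 : (Fintype.card {j // p j} : ℝ) * (n / 2 ^ 15) ≤ k * n := by linarith
    have h4 : (Fintype.card {j // p j} : ℝ) / 2 ^ 15 * n ≤ k * n := by linarith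
    have h5 := le_of_mul_le_mul_right h4 hn
    rw [div_le_iff₀ (by norm_num)] at h5
    linarith
  -- accuracy `8 * (1 / 128) = 1 / 16` on the long directions
  have hB1 := h.measure_exists_abs_gt_le hℓ0 hb₁ hn.le (fun j => hbn j) (γ := 1 / 128)
    (by norm_num) (by norm_num)
  have hB2 := h.measure_exists_sum_sq_gt_le hℓ0 hb₂ (s := n / 2 ^ 15) (by positivity)
    (fun j => not_lt.1 j.2)
  have hP1 : 4 * 25 ^ Fintype.card {j // p j} * Real.exp (-((1 / 128) ^ 2 * ℓ / 96)) ≤ δ / 2 := by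
    refine le_trans ?_ hδ2
    have e4 : (25 : ℝ) ≤ Real.exp 4 := by
      have := Real.exp_one_gt_d9
      rw [show (4 : ℝ) = 1 + 1 + 1 + 1 by norm_num, Real.exp_add, Real.exp_add, Real.exp_add]
      have h2 : 7 ≤ Real.exp 1 * Real.exp 1 := by nlinarith
      nlinarith
    have e2 : (4 : ℝ) ≤ Real.exp 4 := by linarith
    have h25 : (25 : ℝ) ^ Fintype.card {j // p j} ≤ Real.exp (4 * (32768 * k)) := by
      calc (25 : ℝ) ^ Fintype.card {j // p j} ≤ Real.exp 4 ^ Fintype.card {j // p j} :=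
            pow_le_pow_left₀ (by norm_num) e4 _
        _ = Real.exp (4 * Fintype.card {j // p j}) := by rw [← Real.exp_nat_mul, mul_comm]
        _ ≤ _ := Real.exp_le_exp.2 (by linarith)
    calc 4 * 25 ^ Fintype.card {j // p j} * Real.exp (-((1 / 128) ^ 2 * ℓ / 96))
        ≤ Real.exp 4 * Real.exp (4 * (32768 * k)) * Real.exp (-((1 / 128) ^ 2 * ℓ / 96)) := by
          gcongr
      _ ≤ _ := by
          rw [← Real.exp_add, ← Real.exp_add]
          refine Real.exp_le_exp.2 ?_
          linarith
  have hP2 : Real.exp (-(2 * (ℓ : ℝ))) ≤ δ / 2 := by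
    refine le_trans (Real.exp_le_exp.2 ?_) hδ2
    linarith
  have hfin : ENNReal.ofReal δ = ENNReal.ofReal (δ / 2) + ENNReal.ofReal (δ / 2) := by
    rw [← ENNReal.ofReal_add (by positivity) (by positivity), add_halves]
  rw [hfin]
  refine (measure_mono fun y hy => ?_).trans ((measure_union_le _ _).trans (add_le_add
    (hB1.trans (ENNReal.ofReal_le_ofReal hP1)) (hB2.trans (ENNReal.ofReal_le_ofReal hP2))))
  by_contra hcon
  rw [Set.mem_union, not_or] at hcon
  simp only [Set.mem_ofPred_eq, not_not] at hcon
  refine hy fun c => ?_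
  have hc1 := hcon.1 fun j => c j
  have hc2 := hcon.2 fun j => c j
  obtain ⟨h₁, hh₁⟩ : ∃ h₁, h₁ = ∑ j : {j // p j}, c j • b₁ j := ⟨_, rfl⟩
  obtain ⟨h₂, hh₂⟩ : ∃ h₂, h₂ = ∑ j : {j // ¬p j}, c j • b₂ j := ⟨_, rfl⟩
  have hsq₁ : h₁ ⬝ᵥ h₁ = ∑ j : {j // p j}, c j ^ 2 * (b₁ j ⬝ᵥ b₁ j) := by
    rw [hh₁]; exact dotProduct_self_sum_smul hb₁ _
  have hsq₂ : h₂ ⬝ᵥ h₂ = ∑ j : {j // ¬p j}, c j ^ 2 * (b₂ j ⬝ᵥ b₂ j) := by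
    rw [hh₂]; exact dotProduct_self_sum_smul hb₂ _
  have hsqc : (∑ j, c j • b j) ⬝ᵥ (∑ j, c j • b j) = h₁ ⬝ᵥ h₁ + h₂ ⬝ᵥ h₂ := by
    rw [dotProduct_self_sum_smul hb, hsq₁, hsq₂]
    exact (Fintype.sum_subtype_add_sum_subtype p fun j => c j ^ 2 * (b j ⬝ᵥ b j)).symm
  have hhc : ∑ j, c j • b j = h₁ + h₂ := by
    rw [hh₁, hh₂]
    exact (Fintype.sum_subtype_add_sum_subtype p fun j => c j • b j).symm
  have hcc : ∑ j, c j ^ 2 = ∑ j : {j // p j}, c j ^ 2 + ∑ j : {j // ¬p j}, c j ^ 2 :=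
    (Fintype.sum_subtype_add_sum_subtype p fun j => c j ^ 2).symm
  rw [← hh₁] at hc1
  rw [← hh₂] at hc2
  rw [hsqc, hhc, hcc]
  simp only [add_dotProduct]
  obtain ⟨x, hx⟩ : ∃ x, x = ∑ j : {j // p j}, c j ^ 2 := ⟨_, rfl⟩
  obtain ⟨z, hz⟩ : ∃ z, z = ∑ j : {j // ¬p j}, c j ^ 2 := ⟨_, rfl⟩
  have hx0 : 0 ≤ x := hx ▸ Finset.sum_nonneg fun _ _ => sq_nonneg _
  have hz0 : 0 ≤ z := hz ▸ Finset.sum_nonneg fun _ _ => sq_nonneg _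
  rw [← hx] at hc1 ⊢
  rw [← hz] at hc2 ⊢
  have hn1 : h₁ ⬝ᵥ h₁ ≤ n * x := by
    rw [hsq₁, hx, Finset.mul_sum]
    exact Finset.sum_le_sum fun j _ => by
      rw [mul_comm n]; exact mul_le_mul_of_nonneg_left (hbn j) (sq_nonneg _)
  have hn2 : h₂ ⬝ᵥ h₂ ≤ n / 2 ^ 15 * z := by
    rw [hsq₂, hz, Finset.mul_sum]
    exact Finset.sum_le_sum fun j _ => by
      rw [mul_comm (n / 2 ^ 15)]
      exact mul_le_mul_of_nonneg_left (not_lt.1 j.2) (sq_nonneg _)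
  have hn20 : 0 ≤ h₂ ⬝ᵥ h₂ := Finset.sum_nonneg fun i _ => mul_self_nonneg _
  have hR : 4 * (2 * (∑ j, b₂ j ⬝ᵥ b₂ j) / ℓ + 16 * (n / 2 ^ 15)) ≤ n / 256 := by
    have h1 : ∑ j, b₂ j ⬝ᵥ b₂ j ≤ k * n := by
      have : 0 ≤ ∑ j, b₁ j ⬝ᵥ b₁ j := Finset.sum_nonneg fun j _ => hb0 j
      linarith
    have h2 : 2 * (∑ j, b₂ j ⬝ᵥ b₂ j) / ℓ ≤ n / 2048 := by
      rw [div_le_iff₀ hℓ']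
      have : 4096 * k ≤ ℓ := by linarith
      nlinarith
    linarith
  have hE : ∑ i, (h₂ ⬝ᵥ y i) ^ 2 ≤ n / 256 * z := hc2.trans (mul_le_mul_of_nonneg_right hR hz0)
  have hA : ∑ i, (h₁ ⬝ᵥ y i) ^ 2 ≤ 17 / 16 * (n * x) := by
    have := (abs_le.1 hc1).2
    linarith
  have hcross := abs_sum_add_sq_sub_le hA hE
  have hnx := mul_nonneg hn.le hx0
  have hnz := mul_nonneg hn.le hz0
  rw [abs_le] at hcross hc1 ⊢
  constructor <;> linarith

end IsotropicSubgaussian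

/-! ### Spectral norms and quadratic forms -/

theorem inner_toEuclideanLin {d : ℕ} (M : Matrix (Fin d) (Fin d) ℝ)
    (x y : EuclideanSpace ℝ (Fin d)) :
    inner ℝ x (Matrix.toEuclideanLin M y) = x.ofLp ⬝ᵥ M *ᵥ y.ofLp := by
  rw [EuclideanSpace.inner_eq_star_dotProduct]
  simp [Matrix.toLpLin_apply, dotProduct_comm]

theorem dotProduct_self_eq_norm_sq {ι : Type*} [Fintype ι] (x : EuclideanSpace ℝ ι) :
    x.ofLp ⬝ᵥ x.ofLp = ‖x‖ ^ 2 := by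
  rw [EuclideanSpace.real_norm_sq_eq]
  exact Finset.sum_congr rfl fun i _ => (sq _).symm

theorem specNorm_nonneg {m n : ℕ} (A : Matrix (Fin m) (Fin n) ℝ) : 0 ≤ specNorm A :=
  norm_nonneg _

theorem norm_toEuclideanLin_le {m n : ℕ} (A : Matrix (Fin m) (Fin n) ℝ)
    (x : EuclideanSpace ℝ (Fin n)) : ‖Matrix.toEuclideanLin A x‖ ≤ specNorm A * ‖x‖ :=
  (LinearMap.toContinuousLinearMap (Matrix.toEuclideanLin A)).le_opNorm x

theorem abs_dotProduct_mulVec_le {d : ℕ} (M : Matrix (Fin d) (Fin d) ℝ) (x : Fin d → ℝ) :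
    |x ⬝ᵥ M *ᵥ x| ≤ specNorm M * (x ⬝ᵥ x) := by
  have h := abs_real_inner_le_norm (WithLp.toLp 2 x) (Matrix.toEuclideanLin M (WithLp.toLp 2 x))
  rw [inner_toEuclideanLin] at h
  have h2 := norm_toEuclideanLin_le M (WithLp.toLp 2 x)
  have h3 := dotProduct_self_eq_norm_sq (WithLp.toLp 2 x)
  simp only at h h3
  rw [h3]
  nlinarith [norm_nonneg (WithLp.toLp 2 x)]

/-- For a symmetric matrix the spectral norm is the supremum of the Rayleigh quotients. -/
theorem specNorm_le_of_forall_abs_le {d : ℕ} {M : Matrix (Fin d) (Fin d) ℝ} (hM : M.IsHermitian)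
    {K : ℝ} (hK : 0 ≤ K) (h : ∀ x : Fin d → ℝ, |x ⬝ᵥ M *ᵥ x| ≤ K * (x ⬝ᵥ x)) :
    specNorm M ≤ K := by
  have hs : (Matrix.toEuclideanLin M).IsSymmetric := Matrix.isSymmetric_toEuclideanLin_iff.2 hM
  unfold specNorm
  rw [ContinuousLinearMap.norm_eq_iSup_rayleighQuotient _ (by exact hs)]
  refine ciSup_le fun x => ?_
  rw [ContinuousLinearMap.rayleighQuotient, abs_div, abs_of_nonneg (sq_nonneg ‖x‖)]
  refine div_le_of_le_mul₀ (sq_nonneg _) hK ?_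
  have h1 := h x.ofLp
  rw [dotProduct_self_eq_norm_sq, ← inner_toEuclideanLin, real_inner_comm] at h1
  exact h1

/-- The quadratic form of the sketching error of `B` compares the sketched and the true squared length
of `B x`. -/
theorem dotProduct_sketch_mulVec {d ℓ : ℕ} (B : Matrix (Fin d) (Fin d) ℝ)
    (S : Matrix (Fin d) (Fin ℓ) ℝ) (x : Fin d → ℝ) :
    x ⬝ᵥ (B.transpose * S * S.transpose * B - B.transpose * B) *ᵥ x =
      ∑ i, ((B *ᵥ x) ⬝ᵥ fun j => S j i) ^ 2 - (B *ᵥ x) ⬝ᵥ (B *ᵥ x) := by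
  have h1 : x ⬝ᵥ (B.transpose * B) *ᵥ x = (B *ᵥ x) ⬝ᵥ (B *ᵥ x) := by
    rw [← Matrix.mulVec_mulVec, Matrix.dotProduct_mulVec, Matrix.vecMul_transpose]
  have h2 : x ⬝ᵥ (B.transpose * S * S.transpose * B) *ᵥ x =
      (S.transpose *ᵥ (B *ᵥ x)) ⬝ᵥ (S.transpose *ᵥ (B *ᵥ x)) := by
    rw [Matrix.mul_assoc, ← Matrix.transpose_transpose S, ← Matrix.transpose_mul,
      Matrix.transpose_transpose, ← Matrix.mulVec_mulVec, Matrix.dotProduct_mulVec,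
      Matrix.vecMul_transpose, Matrix.mulVec_mulVec]
  rw [Matrix.sub_mulVec, dotProduct_sub, h1, h2]
  congr 1
  refine Finset.sum_congr rfl fun i _ => ?_
  rw [sq]
  simp only [Matrix.mulVec, dotProduct, Matrix.transpose_apply, mul_comm]

theorem isHermitian_sketch_error {d ℓ : ℕ} (B : Matrix (Fin d) (Fin d) ℝ)
    (S : Matrix (Fin d) (Fin ℓ) ℝ) :
    (B.transpose * S * S.transpose * B - B.transpose * B).IsHermitian := by
  rw [Matrix.IsHermitian, Matrix.conjTranspose_eq_transpose_of_trivial]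
  simp [Matrix.transpose_mul, Matrix.mul_assoc]

theorem frobSq_eq_trace {m n : ℕ} (B : Matrix (Fin m) (Fin n) ℝ) :
    frobSq B = (B.transpose * B).trace := by
  simp only [frobSq, Matrix.trace, Matrix.diag, Matrix.mul_apply, Matrix.transpose_apply]
  rw [Finset.sum_comm]
  simp only [sq]

theorem frobSq_nonneg {m n : ℕ} (B : Matrix (Fin m) (Fin n) ℝ) : 0 ≤ frobSq B :=
  Finset.sum_nonneg fun _ _ => Finset.sum_nonneg fun _ _ => sq_nonneg _

theorem frobSq_pos {m n : ℕ} {B : Matrix (Fin m) (Fin n) ℝ} (hB : B ≠ 0) : 0 < frobSq B := by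
  refine lt_of_le_of_ne (frobSq_nonneg B) fun h => hB ?_
  ext i j
  have h1 := (Finset.sum_eq_zero_iff_of_nonneg fun i _ =>
    Finset.sum_nonneg fun j _ => sq_nonneg (B i j)).1 h.symm i (Finset.mem_univ _)
  have h2 := (Finset.sum_eq_zero_iff_of_nonneg fun j _ => sq_nonneg (B i j)).1 h1 j
    (Finset.mem_univ _)
  simpa using h2

/-- The right singular vectors of `B` turn the quadratic form of `B` into a sum over an orthogonal
family. -/
theorem exists_orthogonal_family {d : ℕ} (B : Matrix (Fin d) (Fin d) ℝ) :
    ∃ b : Fin d → Fin d → ℝ, (∀ j j', j ≠ j' → b j ⬝ᵥ b j' = 0) ∧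
      (∀ j, b j ⬝ᵥ b j ≤ specNorm B ^ 2) ∧ ∑ j, b j ⬝ᵥ b j = frobSq B ∧
      ∀ x : Fin d → ℝ, ∃ c : Fin d → ℝ, B *ᵥ x = ∑ j, c j • b j ∧ ∑ j, c j ^ 2 = x ⬝ᵥ x := by
  have hH : (B.transpose * B).IsHermitian := by
    rw [Matrix.IsHermitian, Matrix.conjTranspose_eq_transpose_of_trivial]
    simp [Matrix.transpose_mul]
  obtain ⟨v, hv⟩ : ∃ v, v = hH.eigenvectorBasis := ⟨_, rfl⟩
  have hinner : ∀ j j', (B *ᵥ (v j).ofLp) ⬝ᵥ (B *ᵥ (v j').ofLp) =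
      hH.eigenvalues j' * inner ℝ (v j) (v j') := by
    intro j j'
    have h1 : (B *ᵥ (v j).ofLp) ⬝ᵥ (B *ᵥ (v j').ofLp) =
        (v j).ofLp ⬝ᵥ (B.transpose * B) *ᵥ (v j').ofLp := by
      rw [← Matrix.mulVec_mulVec, Matrix.dotProduct_mulVec, Matrix.dotProduct_mulVec,
        Matrix.vecMul_transpose, Matrix.dotProduct_mulVec]
    rw [h1, hv, hH.mulVec_eigenvectorBasis, dotProduct_smul,
      EuclideanSpace.inner_eq_star_dotProduct]
    simp [dotProduct_comm]
  refine ⟨fun j => B *ᵥ (v j).ofLp, fun j j' hj => ?_, fun j => ?_, ?_, fun x => ?_⟩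
  · rw [hinner, v.inner_eq_zero hj, mul_zero]
  · have h1 := norm_toEuclideanLin_le B (v j)
    rw [v.norm_eq_one, mul_one] at h1
    have h2 := dotProduct_self_eq_norm_sq (Matrix.toEuclideanLin B (v j))
    have h3 : (Matrix.toEuclideanLin B (v j)).ofLp = B *ᵥ (v j).ofLp := by
      simp [Matrix.toLpLin_apply]
    rw [h3] at h2
    rw [h2]
    exact pow_le_pow_left₀ (norm_nonneg _) h1 2
  · rw [frobSq_eq_trace, hH.trace_eq_sum_eigenvalues]
    refine Finset.sum_congr rfl fun j _ => ?_
    rw [hinner, real_inner_self_eq_norm_sq, v.norm_eq_one]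
    simp
  · refine ⟨fun j => v.repr (WithLp.toLp 2 x) j, ?_, ?_⟩
    · have h1 := congrArg WithLp.ofLp (v.sum_repr (WithLp.toLp 2 x))
      simp only [WithLp.ofLp_sum, WithLp.ofLp_smul] at h1
      conv_lhs => rw [← h1]
      rw [Matrix.mulVec_sum]
      simp only [Matrix.mulVec_smul]
    · rw [← EuclideanSpace.real_norm_sq_eq, LinearIsometryEquiv.norm_map,
        ← dotProduct_self_eq_norm_sq]

/-! ### Gaussian and Rademacher sketches -/

/-- An array of i.i.d. variables has the same law when read by rows and by columns. -/
theorem pi_pi_eq_map_swap (d ℓ : ℕ) (ρ : Measure ℝ) [IsProbabilityMeasure ρ] :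
    (Measure.pi fun _ : Fin d => Measure.pi fun _ : Fin ℓ => ρ) =
      (Measure.pi fun _ : Fin ℓ => Measure.pi fun _ : Fin d => ρ).map
        fun y j i => y i j := by
  have key : ∀ m n : ℕ, (Measure.pi fun _ : Fin m => Measure.pi fun _ : Fin n => ρ) =
      (Measure.pi fun _ : Fin m × Fin n => ρ).map fun z j i => z (j, i) := by
    intro m n
    have := Measure.infinitePi_map_curry (ι := Fin m) (κ := Fin n) fun _ _ => ρ
    simp only [Measure.infinitePi_eq_pi] at this
    rw [← this]
    rfl
  rw [key d ℓ, key ℓ d, Measure.map_map (by fun_prop) (by fun_prop)]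
  have hswap := (measurePreserving_piCongrLeft (fun _ : Fin d × Fin ℓ => ρ)
    (Equiv.prodComm (Fin ℓ) (Fin d))).map_eq
  rw [← hswap, Measure.map_map (by fun_prop) (by fun_prop)]
  congr 1

/-- The i.i.d. matrix as a sample of `ℓ` independent columns. -/
theorem iidMatrix_eq_map (d ℓ : ℕ) (ρ : Measure ℝ) [IsProbabilityMeasure ρ] :
    iidMatrix d ℓ ρ = (Measure.pi fun _ : Fin ℓ => Measure.pi fun _ : Fin d => ρ).map
      fun y => Matrix.of fun j i => y i j := by
  have hof : Measurable (Matrix.of : (Fin d → Fin ℓ → ℝ) → Matrix (Fin d) (Fin ℓ) ℝ) :=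
    measurable_id
  rw [iidMatrix, pi_pi_eq_map_swap, Measure.map_map hof (by fun_prop)]
  rfl

/-- The set `s` need not be measurable. -/
theorem one_sub_le_measureReal {Ω : Type*} [MeasurableSpace Ω] {P : Measure Ω}
    [IsProbabilityMeasure P] {s : Set Ω} {δ : ℝ} (hδ : 0 ≤ δ) (h : P sᶜ ≤ ENNReal.ofReal δ) :
    1 - δ ≤ P.real s := by
  have h1 := measureReal_union_le (μ := P) s sᶜ
  rw [Set.union_compl_self, probReal_univ] at h1
  have h2 : P.real sᶜ ≤ δ := ENNReal.toReal_le_of_le_ofReal hδ h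
  linarith

/-- Mean zero, variance `1 / ℓ` and sub-Gaussian variance proxy `1 / ℓ` of the entries are all that the
sketching property needs. -/
theorem isObliviousSketch_iidMatrix {d ℓ : ℕ} {ρ : Measure ℝ} [IsProbabilityMeasure ρ]
    (hs : HasSubgaussianMGF id ((ℓ : ℝ≥0)⁻¹) ρ) (hm : ∫ x, x ∂ρ = 0)
    (hv : ∫ x, x ^ 2 ∂ρ = (ℓ : ℝ)⁻¹) {k δ : ℝ} (hk : 1 ≤ k) (hδ : 0 < δ) (hδ1 : δ < 1)
    (hℓ : 10 ^ 12 * (k + Real.log (1 / δ)) ≤ ℓ) :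
    IsObliviousSketch (iidMatrix d ℓ ρ) (1 / 4) k δ := by
  intro B
  have hiso : IsotropicSubgaussian (Measure.pi fun _ : Fin d => ρ) ((ℓ : ℝ)⁻¹) := by
    have := isotropicSubgaussian_pi (d := d) hs hm (by rw [hv]; simp)
    simpa using this
  have hT : Measurable fun y : Fin ℓ → Fin d → ℝ =>
      (Matrix.of fun j i => y i j : Matrix (Fin d) (Fin ℓ) ℝ) := by
    have : Measurable fun (y : Fin ℓ → Fin d → ℝ) (j : Fin d) (i : Fin ℓ) => y i j := by fun_prop
    exact this
  have : IsProbabilityMeasure (iidMatrix d ℓ ρ) := by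
    rw [iidMatrix_eq_map]
    exact Measure.isProbabilityMeasure_map hT.aemeasurable
  rcases eq_or_ne B 0 with rfl | hB
  · have h0 : ∀ m n : ℕ, specNorm (0 : Matrix (Fin m) (Fin n) ℝ) = 0 := fun m n => by
      simp [specNorm]
    simp [h0, frobSq, hδ.le]
  have hF := frobSq_pos hB
  have hk0 : 0 < k := by linarith
  obtain ⟨b, hb, hbs, hbF, hrep⟩ := exists_orthogonal_family B
  obtain ⟨n, hn⟩ : ∃ n, n = specNorm B ^ 2 + frobSq B / k := ⟨_, rfl⟩
  have hFk : 0 < frobSq B / k := by positivity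
  have hmain := hiso.measure_not_sketch_le hb (n := n) (k := k) (by rw [hn]; positivity)
    (fun j => (hbs j).trans (by rw [hn]; linarith)) hk
    (by
      rw [hbF, hn, mul_add, mul_div_cancel₀ _ hk0.ne']
      nlinarith [sq_nonneg (specNorm B)]) hδ hδ1 hℓ
  have hgood := one_sub_le_measureReal (s := {y : Fin ℓ → Fin d → ℝ | ∀ c : Fin d → ℝ,
      |∑ i, ((∑ j, c j • b j) ⬝ᵥ y i) ^ 2 - (∑ j, c j • b j) ⬝ᵥ (∑ j, c j • b j)| ≤
        1 / 4 * n * ∑ j, c j ^ 2}) hδ.le hmain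
  refine hgood.trans ?_
  rw [iidMatrix_eq_map]
  have hprob := Measure.isProbabilityMeasure_map
    (μ := Measure.pi fun _ : Fin ℓ => Measure.pi fun _ : Fin d => ρ) hT.aemeasurable
  refine ENNReal.toReal_mono (measure_ne_top _ _) ((measure_mono fun y hy => ?_).trans
    (Measure.le_map_apply hT.aemeasurable _))
  refine specNorm_le_of_forall_abs_le (isHermitian_sketch_error _ _) ?_ fun x => ?_
  · rw [← hn]
    have : 0 < n := by rw [hn]; positivity
    positivity
  · obtain ⟨c, hc1, hc2⟩ := hrep x
    rw [dotProduct_sketch_mulVec, ← hn, hc1, ← hc2]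
    exact hy c

theorem isObliviousSketch_gaussianSketch {d ℓ : ℕ} {k δ : ℝ} (hk : 1 ≤ k) (hδ : 0 < δ)
    (hδ1 : δ < 1) (hℓ : 10 ^ 12 * (k + Real.log (1 / δ)) ≤ ℓ) :
    IsObliviousSketch (gaussianSketch d ℓ) (1 / 4) k δ := by
  refine isObliviousSketch_iidMatrix ⟨fun t => ?_, fun t => ?_⟩ integral_id_gaussianReal ?_
    hk hδ hδ1 hℓ
  · exact integrable_exp_mul_gaussianReal t
  · have := congrFun (mgf_fun_id_gaussianReal (μ := 0) (v := (ℓ : ℝ≥0)⁻¹)) t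
    refine (le_of_eq this).trans (le_of_eq ?_)
    simp
  · have h1 := variance_of_integral_eq_zero (μ := gaussianReal 0 ((ℓ : ℝ≥0)⁻¹))
      (X := fun x => x) (by fun_prop) integral_id_gaussianReal
    rw [variance_fun_id_gaussianReal] at h1
    rw [← h1]
    simp

theorem isObliviousSketch_rademacherSketch {d ℓ : ℕ} {k δ : ℝ} (hk : 1 ≤ k) (hδ : 0 < δ)
    (hδ1 : δ < 1) (hℓ : 10 ^ 12 * (k + Real.log (1 / δ)) ≤ ℓ) :
    IsObliviousSketch (rademacherSketch d ℓ) (1 / 4) k δ := by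
  obtain ⟨a, ha⟩ : ∃ a : ℝ, a = 1 / √(ℓ : ℝ) := ⟨_, rfl⟩
  obtain ⟨ρ, hρ⟩ : ∃ ρ : Measure ℝ, ρ = (2⁻¹ : ℝ≥0∞) • Measure.dirac a +
    (2⁻¹ : ℝ≥0∞) • Measure.dirac (-a) := ⟨_, rfl⟩
  have ha0 : 0 ≤ a := by rw [ha]; positivity
  have ha2 : a ^ 2 = (ℓ : ℝ)⁻¹ := by
    rw [ha, div_pow, Real.sq_sqrt (Nat.cast_nonneg _)]; simp
  have hprob : IsProbabilityMeasure ρ := ⟨by rw [hρ]; simp [ENNReal.inv_two_add_inv_two]⟩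
  have hint : ∀ g : ℝ → ℝ, ∫ x, g x ∂ρ = (g a + g (-a)) / 2 := fun g => by
    rw [hρ, integral_add_measure, integral_smul_measure, integral_smul_measure, integral_dirac,
      integral_dirac]
    · simp; ring
    · exact (integrable_dirac (by finiteness)).smul_measure (by simp)
    · exact (integrable_dirac (by finiteness)).smul_measure (by simp)
  have hmean : ∫ x, x ∂ρ = 0 := by rw [hint]; simp
  have hsub : HasSubgaussianMGF id ((ℓ : ℝ≥0)⁻¹) ρ := by
    have h1 := hasSubgaussianMGF_of_mem_Icc_of_integral_eq_zero (μ := ρ) (X := id) (a := -a)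
      (b := a) aemeasurable_id (by
        rw [hρ, ae_add_measure_iff]
        constructor <;> refine Measure.ae_smul_measure ?_ _ <;>
          rw [ae_dirac_eq] <;> simp [ha0]) hmean
    have h2 : ((‖a - -a‖₊ / 2) ^ 2 : ℝ≥0) = (ℓ : ℝ≥0)⁻¹ := by
      apply NNReal.eq
      push_cast
      rw [← ha2, sub_neg_eq_add, Real.norm_eq_abs, div_pow, sq_abs]
      ring
    rwa [h2] at h1
  have := isObliviousSketch_iidMatrix (d := d) hsub hmean (by rw [hint, neg_sq, ha2]; ring)
    hk hδ hδ1 hℓ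
  rw [hρ, ha] at this
  exact this

/-! ### One sketch controls curvature and gradient -/

theorem exists_factor_of_posSemidef {d : ℕ} {M : Matrix (Fin d) (Fin d) ℝ} (hM : M.PosSemidef) :
    ∃ X : Matrix (Fin d) (Fin d) ℝ, M = X.transpose * X := by
  open scoped MatrixOrder in
  obtain ⟨X, hX⟩ := CStarAlgebra.nonneg_iff_eq_star_mul_self.mp hM.nonneg
  exact ⟨X, by rw [hX, Matrix.star_eq_conjTranspose, Matrix.conjTranspose_eq_transpose_of_trivial]⟩

theorem dotProduct_transpose_mul_self_mulVec {d : ℕ} (X : Matrix (Fin d) (Fin d) ℝ)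
    (x y : Fin d → ℝ) : x ⬝ᵥ (X.transpose * X) *ᵥ y = (X *ᵥ x) ⬝ᵥ (X *ᵥ y) := by
  rw [← Matrix.mulVec_mulVec, Matrix.dotProduct_mulVec, Matrix.vecMul_transpose]

theorem zero_le_dotProduct_self {d : ℕ} (x : Fin d → ℝ) : 0 ≤ x ⬝ᵥ x :=
  Finset.sum_nonneg fun _ _ => mul_self_nonneg _

theorem dotProduct_sq_le {d : ℕ} (x y : Fin d → ℝ) : (x ⬝ᵥ y) ^ 2 ≤ (x ⬝ᵥ x) * (y ⬝ᵥ y) := by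
  have := Finset.sum_mul_sq_le_sq_mul_sq Finset.univ x y
  simpa only [dotProduct, ← sq] using this

/-- Cauchy-Schwarz for the semi-inner product of a positive semidefinite matrix. -/
theorem dotProduct_mulVec_sq_le {d : ℕ} {A : Matrix (Fin d) (Fin d) ℝ} (hA : A.PosSemidef)
    (x y : Fin d → ℝ) : (x ⬝ᵥ A *ᵥ y) ^ 2 ≤ (x ⬝ᵥ A *ᵥ x) * (y ⬝ᵥ A *ᵥ y) := by
  obtain ⟨X, rfl⟩ := exists_factor_of_posSemidef hA
  simp only [dotProduct_transpose_mul_self_mulVec]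
  exact dotProduct_sq_le _ _

/-- For `B Bᵀ = M`, a vector `h` with `(h ⬝ z)² ≤ s (z ⬝ M z)` for all `z` is the image under `B` of
a vector of squared length at most `s`. Thus the sketch of the single matrix `B` controls the
sketched length of every such `h`. -/
theorem IsObliviousSketch.le_measureReal_forall {d ℓ : ℕ}
    {ν : Measure (Matrix (Fin d) (Fin ℓ) ℝ)} [IsFiniteMeasure ν] {k δ : ℝ}
    (hν : IsObliviousSketch ν (1 / 4) k δ) (hk : 0 < k) {M : Matrix (Fin d) (Fin d) ℝ}
    (hM : M.PosDef) {m : ℝ} (hm0 : 0 ≤ m) (hm : ∀ z : Fin d → ℝ, z ⬝ᵥ M *ᵥ z ≤ m * (z ⬝ᵥ z)) :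
    1 - δ ≤ ν.real {S | ∀ (h : Fin d → ℝ) (s : ℝ), 0 ≤ s →
      (∀ z : Fin d → ℝ, (h ⬝ᵥ z) ^ 2 ≤ s * (z ⬝ᵥ M *ᵥ z)) →
      |∑ i, (h ⬝ᵥ fun j => S j i) ^ 2 - h ⬝ᵥ h| ≤ 1 / 4 * (m + M.trace / k) * s} := by
  obtain ⟨X, hX⟩ := exists_factor_of_posSemidef hM.posSemidef
  have hXm : ∀ z : Fin d → ℝ, (X *ᵥ z) ⬝ᵥ (X *ᵥ z) ≤ m * (z ⬝ᵥ z) := fun z => by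
    rw [← dotProduct_transpose_mul_self_mulVec, ← hX]; exact hm z
  -- `‖Xᵀ‖₂ = ‖X‖₂ ≤ √m`, by duality
  have hspec : specNorm X.transpose ≤ Real.sqrt m := by
    refine ContinuousLinearMap.opNorm_le_bound _ (Real.sqrt_nonneg _) fun w => ?_
    obtain ⟨y, hy⟩ : ∃ y, y = X.transpose *ᵥ w.ofLp := ⟨_, rfl⟩
    have hyw : y ⬝ᵥ y = w.ofLp ⬝ᵥ (X *ᵥ y) := by
      nth_rewrite 1 [hy]
      rw [Matrix.mulVec_transpose, ← Matrix.dotProduct_mulVec]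
    have h1 := dotProduct_sq_le w.ofLp (X *ᵥ y)
    rw [← hyw] at h1
    have h2 : (y ⬝ᵥ y) ^ 2 ≤ (w.ofLp ⬝ᵥ w.ofLp) * (m * (y ⬝ᵥ y)) :=
      h1.trans (mul_le_mul_of_nonneg_left (hXm y) (zero_le_dotProduct_self _))
    have h3 : y ⬝ᵥ y ≤ m * (w.ofLp ⬝ᵥ w.ofLp) := by
      rcases (zero_le_dotProduct_self y).eq_or_lt with h0 | h0
      · rw [← h0]; exact mul_nonneg hm0 (zero_le_dotProduct_self _)
      · nlinarith
    have h4 := dotProduct_self_eq_norm_sq (Matrix.toEuclideanLin X.transpose w)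
    have h5 : (Matrix.toEuclideanLin X.transpose w).ofLp = y := by
      rw [hy]; simp [Matrix.toLpLin_apply]
    rw [h5] at h4
    rw [h4, dotProduct_self_eq_norm_sq w] at h3
    change ‖Matrix.toEuclideanLin X.transpose w‖ ≤ _
    refine (pow_le_pow_iff_left₀ (norm_nonneg _) (by positivity) two_ne_zero).1 ?_
    rw [mul_pow, Real.sq_sqrt hm0]
    exact h3
  have hspec2 : specNorm X.transpose ^ 2 ≤ m := by
    have := pow_le_pow_left₀ (specNorm_nonneg _) hspec 2
    rwa [Real.sq_sqrt hm0] at this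
  have hfrob : frobSq X.transpose = M.trace := by
    rw [frobSq_eq_trace, Matrix.trace_mul_comm, hX, Matrix.transpose_transpose]
  refine (hν X.transpose).trans (measureReal_mono fun S hS h s hs hh => ?_)
  -- the preimage `w = X M⁻¹ h` of `h` under `B = Xᵀ`
  obtain ⟨z, hz⟩ : ∃ z, z = M⁻¹ *ᵥ h := ⟨_, rfl⟩
  have hMz : M *ᵥ z = h := by
    rw [hz, Matrix.mulVec_mulVec, Matrix.mul_nonsing_inv _ ((Matrix.isUnit_iff_isUnit_det _).1
      hM.isUnit), Matrix.one_mulVec]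
  obtain ⟨w, hw⟩ : ∃ w, w = X *ᵥ z := ⟨_, rfl⟩
  have hBw : X.transpose *ᵥ w = h := by
    rw [hw, Matrix.mulVec_mulVec, ← hX, hMz]
  have hww : w ⬝ᵥ w = z ⬝ᵥ M *ᵥ z := by
    rw [hw, hX, dotProduct_transpose_mul_self_mulVec]
  have hws : w ⬝ᵥ w ≤ s := by
    have h1 := hh z
    have h2 : h ⬝ᵥ z = w ⬝ᵥ w := by rw [hww, hMz, dotProduct_comm]
    rw [h2, ← hww] at h1
    rcases (zero_le_dotProduct_self w).eq_or_lt with h0 | h0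
    · rw [← h0]; exact hs
    · nlinarith
  have h1 := abs_dotProduct_mulVec_le (X.transpose.transpose * S * S.transpose * X.transpose -
    X.transpose.transpose * X.transpose) w
  rw [dotProduct_sketch_mulVec, hBw] at h1
  have htr : 0 ≤ M.trace := by rw [← hfrob]; exact frobSq_nonneg _
  have hS' : specNorm (X.transpose.transpose * S * S.transpose * X.transpose -
      X.transpose.transpose * X.transpose) ≤ 1 / 4 * (m + M.trace / k) := by
    refine le_trans hS ?_
    rw [hfrob]
    linarith
  calc _ ≤ _ := h1
    _ ≤ 1 / 4 * (m + M.trace / k) * (w ⬝ᵥ w) :=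
      mul_le_mul_of_nonneg_right hS' (zero_le_dotProduct_self _)
    _ ≤ _ := mul_le_mul_of_nonneg_left hws (by positivity)

/-- A single sketching event bounds the curvature of `A` along the range of `S` and at the same time
keeps the length of a given vector `g`. It is the event for a square root of
`τ A + g gᵀ / ‖g‖²` with `τ (‖A‖₂ + tr A / k) = 1`. -/
theorem IsObliviousSketch.le_measureReal_curvature_and_gradient {d ℓ : ℕ}
    {ν : Measure (Matrix (Fin d) (Fin ℓ) ℝ)} [IsFiniteMeasure ν] {k δ : ℝ}
    (hν : IsObliviousSketch ν (1 / 4) k δ) (hk : 1 ≤ k) {A : Matrix (Fin d) (Fin d) ℝ}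
    (hA : A.PosDef) (ha : 0 < specNorm A) (g : Fin d → ℝ) :
    1 - δ ≤ ν.real {S | (∀ q : Fin ℓ → ℝ, (S *ᵥ q) ⬝ᵥ A *ᵥ (S *ᵥ q) ≤
        (5 * specNorm A + A.trace / k) * (q ⬝ᵥ q)) ∧
      1 / 4 * (g ⬝ᵥ g) ≤ ∑ i, (g ⬝ᵥ fun j => S j i) ^ 2} := by
  have hk0 : 0 < k := by linarith
  have htr : 0 ≤ A.trace / k := div_nonneg hA.posSemidef.trace_nonneg hk0.le
  obtain ⟨τ, hτ⟩ : ∃ τ, τ = (specNorm A + A.trace / k)⁻¹ := ⟨_, rfl⟩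
  have hsum : 0 < specNorm A + A.trace / k := by linarith
  have hτ0 : 0 < τ := by rw [hτ]; positivity
  have hτ1 : τ * (specNorm A + A.trace / k) = 1 := by rw [hτ]; exact inv_mul_cancel₀ hsum.ne'
  have hG := zero_le_dotProduct_self g
  have hGi : 0 ≤ (g ⬝ᵥ g)⁻¹ := inv_nonneg.2 hG
  -- for `g = 0` the inverse is `0` and the rank-one term vanishes anyway
  obtain ⟨M, hMdef⟩ : ∃ M, M = τ • A + (g ⬝ᵥ g)⁻¹ • Matrix.vecMulVec g g := ⟨_, rfl⟩
  have hMq : ∀ z : Fin d → ℝ,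
      z ⬝ᵥ M *ᵥ z = τ * (z ⬝ᵥ A *ᵥ z) + (g ⬝ᵥ g)⁻¹ * (g ⬝ᵥ z) ^ 2 := by
    intro z
    rw [hMdef, Matrix.add_mulVec, Matrix.smul_mulVec, Matrix.smul_mulVec, dotProduct_add,
      dotProduct_smul, dotProduct_smul, Matrix.vecMulVec_mulVec, smul_eq_mul, smul_eq_mul]
    congr 2
    simp [dotProduct_comm, sq]
  have hMpd : M.PosDef := by
    rw [hMdef]
    refine (hA.smul hτ0).add_posSemidef (Matrix.PosSemidef.smul ?_ hGi)
    have := Matrix.posSemidef_vecMulVec_self_star g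
    simpa using this
  have hAq : ∀ z : Fin d → ℝ, z ⬝ᵥ A *ᵥ z ≤ specNorm A * (z ⬝ᵥ z) := fun z =>
    (le_abs_self _).trans (abs_dotProduct_mulVec_le A z)
  have hAnn : ∀ z : Fin d → ℝ, 0 ≤ z ⬝ᵥ A *ᵥ z := fun z => by
    simpa using hA.posSemidef.dotProduct_mulVec_nonneg z
  have hm : ∀ z : Fin d → ℝ, z ⬝ᵥ M *ᵥ z ≤ (τ * specNorm A + 1) * (z ⬝ᵥ z) := by
    intro z
    rw [hMq]
    have h1 : (g ⬝ᵥ g)⁻¹ * (g ⬝ᵥ z) ^ 2 ≤ z ⬝ᵥ z := by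
      refine (mul_le_mul_of_nonneg_left (dotProduct_sq_le g z) hGi).trans ?_
      rw [← mul_assoc]
      exact mul_le_of_le_one_left (zero_le_dotProduct_self z) inv_mul_le_one
    nlinarith [mul_le_mul_of_nonneg_left (hAq z) hτ0.le]
  have hMtr : M.trace ≤ τ * A.trace + 1 := by
    rw [hMdef, Matrix.trace_add, Matrix.trace_smul, Matrix.trace_smul, Matrix.trace_vecMulVec,
      smul_eq_mul, smul_eq_mul]
    linarith [inv_mul_le_one (a := g ⬝ᵥ g)]
  have hK : 1 / 4 * (τ * specNorm A + 1 + M.trace / k) ≤ 3 / 4 := by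
    have h1 : M.trace / k ≤ τ * (A.trace / k) + 1 := by
      rw [← mul_div_assoc]
      calc M.trace / k ≤ (τ * A.trace + 1) / k := by gcongr
        _ = τ * A.trace / k + 1 / k := add_div _ _ _
        _ ≤ _ := by gcongr; rw [div_le_one hk0]; exact hk
    linarith
  refine (hν.le_measureReal_forall hk0 hMpd (by positivity) hm).trans
    (measureReal_mono fun S hS => ⟨fun q => ?_, ?_⟩)
  -- the event is applied to `h = A y` for `y = S q`, and `yᵀ A y = qᵀ Sᵀ (A y)`
  · obtain ⟨y, hy⟩ : ∃ y, y = S *ᵥ q := ⟨_, rfl⟩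
    rw [← hy]
    obtain ⟨e, he⟩ : ∃ e, e = y ⬝ᵥ A *ᵥ y := ⟨_, rfl⟩
    have he0 : 0 ≤ e := he ▸ hAnn y
    have hsymm : ∀ z : Fin d → ℝ, (A *ᵥ y) ⬝ᵥ z = y ⬝ᵥ A *ᵥ z := fun z => by
      rw [Matrix.dotProduct_mulVec, ← Matrix.mulVec_transpose]
      congr 2
      have := hA.isHermitian
      rw [Matrix.IsHermitian, Matrix.conjTranspose_eq_transpose_of_trivial] at this
      exact this.symm
    have hAz : ∀ z : Fin d → ℝ, ((A *ᵥ y) ⬝ᵥ z) ^ 2 ≤ e * (z ⬝ᵥ A *ᵥ z) := fun z => by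
      rw [hsymm, he]; exact dotProduct_mulVec_sq_le hA.posSemidef y z
    have h1 := hS (A *ᵥ y) (τ⁻¹ * e) (by positivity) fun z => by
      have h2 : z ⬝ᵥ A *ᵥ z ≤ τ⁻¹ * (z ⬝ᵥ M *ᵥ z) := by
        rw [hMq, mul_add, inv_mul_cancel_left₀ hτ0.ne']
        have : 0 ≤ τ⁻¹ * ((g ⬝ᵥ g)⁻¹ * (g ⬝ᵥ z) ^ 2) := by positivity
        linarith
      calc _ ≤ e * (z ⬝ᵥ A *ᵥ z) := hAz z
        _ ≤ e * (τ⁻¹ * (z ⬝ᵥ M *ᵥ z)) := mul_le_mul_of_nonneg_left h2 he0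
        _ = _ := by ring
    have h2 : (A *ᵥ y) ⬝ᵥ (A *ᵥ y) ≤ specNorm A * e := by
      have h3 := (hAz (A *ᵥ y)).trans (mul_le_mul_of_nonneg_left (hAq _) he0)
      rcases (zero_le_dotProduct_self (A *ᵥ y)).eq_or_lt with h0 | h0
      · rw [← h0]; positivity
      · nlinarith
    have h3 : 1 / 4 * (τ * specNorm A + 1 + M.trace / k) * (τ⁻¹ * e) ≤
        3 / 4 * ((specNorm A + A.trace / k) * e) := by
      have : τ⁻¹ = specNorm A + A.trace / k := by rw [hτ, inv_inv]
      rw [this]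
      exact mul_le_mul_of_nonneg_right hK (by positivity)
    have h4 : ∑ i, ((A *ᵥ y) ⬝ᵥ fun j => S j i) ^ 2 ≤
        (5 * specNorm A + A.trace / k) * e := by
      have := (abs_le.1 h1).2
      nlinarith [mul_nonneg ha.le he0, mul_nonneg htr he0]
    have h5 : e = ∑ i, q i * ((A *ᵥ y) ⬝ᵥ fun j => S j i) := by
      rw [he, dotProduct_comm]
      nth_rewrite 2 [hy]
      rw [Matrix.dotProduct_mulVec, dotProduct_comm]
      rfl
    have h6 := Finset.sum_mul_sq_le_sq_mul_sq Finset.univ q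
      fun i => (A *ᵥ y) ⬝ᵥ fun j => S j i
    rw [← h5] at h6
    have hq0 := zero_le_dotProduct_self q
    have hqq : ∑ i, q i ^ 2 = q ⬝ᵥ q := Finset.sum_congr rfl fun i _ => sq _
    rw [hqq] at h6
    have h7 := h6.trans (mul_le_mul_of_nonneg_left h4 hq0)
    rw [← he]
    rcases he0.eq_or_lt with h0 | h0
    · rw [← h0]; positivity
    · nlinarith
  · have h1 := hS g (g ⬝ᵥ g) hG fun z => by
      rw [hMq]
      rcases hG.eq_or_lt with h0 | h0
      · have : g = 0 := dotProduct_self_eq_zero.1 h0.symm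
        simp [this]
      · rw [mul_add, mul_inv_cancel_left₀ h0.ne']
        have : 0 ≤ (g ⬝ᵥ g) * (τ * (z ⬝ᵥ A *ᵥ z)) := mul_nonneg hG (mul_nonneg hτ0.le (hAnn z))
        linarith
    have h2 := (abs_le.1 h1).1
    have h3 := mul_le_mul_of_nonneg_right hK hG
    linarith

/-! ### Descent of the objective -/

/-- The gradient step of the algorithm, as a function of the current point and the sketch. -/
noncomputable def zooStep {d ℓ : ℕ} (f : EuclideanSpace ℝ (Fin d) → ℝ) (α η : ℝ)
    (x : EuclideanSpace ℝ (Fin d)) (S : Matrix (Fin d) (Fin ℓ) ℝ) : EuclideanSpace ℝ (Fin d) :=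
  x - η • ∑ i, ((f (x + α • sketchCol S i) - f (x - α • sketchCol S i)) / (2 * α)) • sketchCol S i

namespace IsConvexQuadratic

variable {d : ℕ} {φ : EuclideanSpace ℝ (Fin d) → ℝ} {A : Matrix (Fin d) (Fin d) ℝ} {μ : ℝ}

/-- Strong convexity at the midpoint of `v` and `-v` bounds the Hessian from below. -/
theorem le_inner_of_strongConvexOn (hφ : IsConvexQuadratic φ A)
    (hμ : StrongConvexOn Set.univ μ φ) (v : EuclideanSpace ℝ (Fin d)) :
    μ * ‖v‖ ^ 2 ≤ inner ℝ v (Matrix.toEuclideanLin A v) := by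
  have h1 := hφ.expansion 0 v
  have h2 := hφ.expansion 0 (-v)
  have hconv := hμ.2
  have h3 := hconv (Set.mem_univ v) (Set.mem_univ (-v)) (by norm_num : (0 : ℝ) ≤ 1 / 2)
    (by norm_num : (0 : ℝ) ≤ 1 / 2) (by norm_num)
  have h4 : (1 / 2 : ℝ) • v + (1 / 2 : ℝ) • -v = 0 := by simp
  have h5 : ‖v - -v‖ = 2 * ‖v‖ := by
    rw [sub_neg_eq_add, ← two_smul ℝ v, norm_smul, Real.norm_two]
  rw [h4, h5] at h3
  simp only [sub_zero, map_neg, inner_neg_right, inner_neg_left, neg_neg, smul_eq_mul] at h1 h2 h3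
  nlinarith

/-- The Polyak-Łojasiewicz inequality. -/
theorem sub_le_norm_gradient_sq (hφ : IsConvexQuadratic φ A)
    (hμ : StrongConvexOn Set.univ μ φ) (hμ0 : 0 < μ) (x y : EuclideanSpace ℝ (Fin d)) :
    2 * μ * (φ x - φ y) ≤ ‖∇ φ x‖ ^ 2 := by
  have h1 := hφ.expansion x y
  have h2 := hφ.le_inner_of_strongConvexOn hμ (y - x)
  have h3 := norm_add_sq_real (∇ φ x) (μ • (y - x))
  rw [inner_smul_right, norm_smul, mul_pow, Real.norm_eq_abs, sq_abs] at h3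
  have h4 := sq_nonneg ‖∇ φ x + μ • (y - x)‖
  nlinarith

theorem posDef_of_strongConvexOn (hφ : IsConvexQuadratic φ A)
    (hμ : StrongConvexOn Set.univ μ φ) (hμ0 : 0 < μ) : A.PosDef := by
  refine Matrix.PosDef.of_dotProduct_mulVec_pos hφ.posSemidef.isHermitian fun x hx => ?_
  have h1 := hφ.le_inner_of_strongConvexOn hμ (WithLp.toLp 2 x)
  rw [inner_toEuclideanLin] at h1
  have h2 : 0 < ‖WithLp.toLp 2 x‖ := norm_pos_iff.2 fun h => hx (by simpa using h)
  have h3 : 0 < μ * ‖WithLp.toLp 2 x‖ ^ 2 := by positivity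
  simpa using h3.trans_le h1

theorem le_specNorm_of_strongConvexOn (hφ : IsConvexQuadratic φ A)
    (hμ : StrongConvexOn Set.univ μ φ) (hd : 0 < d) : μ ≤ specNorm A := by
  have h1 := hφ.le_inner_of_strongConvexOn hμ (EuclideanSpace.single ⟨0, hd⟩ 1)
  have h2 := real_inner_le_norm (EuclideanSpace.single (⟨0, hd⟩ : Fin d) (1 : ℝ))
    (Matrix.toEuclideanLin A (EuclideanSpace.single ⟨0, hd⟩ 1))
  have h3 := norm_toEuclideanLin_le A (EuclideanSpace.single ⟨0, hd⟩ 1)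
  simp only [PiLp.norm_single, norm_one] at h1 h2 h3
  linarith

/-- Symmetric differences of a quadratic are exact directional derivatives. -/
theorem apply_add_sub_apply_sub (hφ : IsConvexQuadratic φ A) (x s : EuclideanSpace ℝ (Fin d)) :
    φ (x + s) - φ (x - s) = 2 * inner ℝ (∇ φ x) s := by
  have h1 := hφ.expansion x (x + s)
  have h2 := hφ.expansion x (x - s)
  rw [add_sub_cancel_left] at h1
  rw [sub_sub_cancel_left] at h2
  simp only [map_neg, inner_neg_right, inner_neg_left, neg_neg] at h2
  linarith

/-- One step contracts the optimality gap, up to the oracle noise, when the sketch is good for the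
Hessian and for the gradient at the current point. -/
theorem zooStep_sub_le (hφ : IsConvexQuadratic φ A) (hμ : StrongConvexOn Set.univ μ φ)
    (hμ0 : 0 < μ) {f : EuclideanSpace ℝ (Fin d) → ℝ} {σ α η : ℝ} (hα : 0 < α)
    (hη : 0 < η) (hf : ∀ x, |f x - φ x| ≤ σ) {ℓ : ℕ} {S : Matrix (Fin d) (Fin ℓ) ℝ}
    {x y : EuclideanSpace ℝ (Fin d)}
    (hcurv : ∀ q : Fin ℓ → ℝ, (S *ᵥ q) ⬝ᵥ A *ᵥ (S *ᵥ q) ≤ η⁻¹ * (q ⬝ᵥ q))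
    (hgrad : 1 / 4 * ((∇ φ x).ofLp ⬝ᵥ (∇ φ x).ofLp) ≤
      ∑ i, ((∇ φ x).ofLp ⬝ᵥ fun j => S j i) ^ 2) :
    φ (zooStep f α η x S) - φ y ≤
      (1 - η * μ / 4) * (φ x - φ y) + η / 2 * (ℓ * (σ / α) ^ 2) := by
  -- `q` are the noisy and `p` the exact directional derivatives
  obtain ⟨q, hq⟩ : ∃ q : Fin ℓ → ℝ, q = fun i =>
    (f (x + α • sketchCol S i) - f (x - α • sketchCol S i)) / (2 * α) := ⟨_, rfl⟩
  obtain ⟨p, hp⟩ : ∃ p : Fin ℓ → ℝ, p = fun i => (∇ φ x).ofLp ⬝ᵥ fun j => S j i := ⟨_, rfl⟩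
  have hpi : ∀ i, inner ℝ (∇ φ x) (sketchCol S i) = p i := fun i => by
    rw [hp, EuclideanSpace.inner_eq_star_dotProduct]
    simp [sketchCol, dotProduct_comm]
  have hnoise : ∀ i, (q i - p i) ^ 2 ≤ (σ / α) ^ 2 := by
    intro i
    have h1 := hφ.apply_add_sub_apply_sub x (α • sketchCol S i)
    rw [inner_smul_right, hpi] at h1
    have h2 := abs_le.1 (hf (x + α • sketchCol S i))
    have h3 := abs_le.1 (hf (x - α • sketchCol S i))
    refine sq_le_sq' ?_ ?_
    · rw [hq, ← neg_div, le_sub_iff_add_le, le_div_iff₀ (by positivity), add_mul, div_mul_eq_mul_div,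
        show -σ * (2 * α) / α = -σ * 2 by field_simp]
      linarith
    · rw [hq, sub_le_iff_le_add, div_le_iff₀ (by positivity), add_mul, div_mul_eq_mul_div,
        show σ * (2 * α) / α = σ * 2 by field_simp]
      linarith
  obtain ⟨g, hg⟩ : ∃ g, g = ∑ i, q i • sketchCol S i := ⟨_, rfl⟩
  have hgS : g.ofLp = S *ᵥ q := by
    rw [hg]
    ext j
    simp [sketchCol, Matrix.mulVec, dotProduct, mul_comm]
  have hstep : zooStep f α η x S = x - η • g := by rw [hg, hq]; rfl
  have h1 := hφ.expansion x (x - η • g)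
  rw [sub_sub_cancel_left] at h1
  simp only [map_neg, inner_neg_right, inner_neg_left, map_smul, inner_smul_left,
    inner_smul_right, RCLike.conj_to_real] at h1
  have hgp : inner ℝ (∇ φ x) g = ∑ i, q i * p i := by
    rw [hg, inner_sum]
    exact Finset.sum_congr rfl fun i _ => by rw [inner_smul_right, hpi]
  have hAg : inner ℝ g (Matrix.toEuclideanLin A g) ≤ η⁻¹ * ∑ i, q i ^ 2 := by
    rw [inner_toEuclideanLin, hgS]
    refine (hcurv q).trans (le_of_eq ?_)
    congr 1
    exact Finset.sum_congr rfl fun i _ => (sq _).symm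
  -- `-q p + q² / 2 = (q - p)² / 2 - p² / 2`
  have hsq : ∑ i, (q i - p i) ^ 2 = ∑ i, q i ^ 2 - 2 * ∑ i, q i * p i + ∑ i, p i ^ 2 := by
    rw [Finset.mul_sum, ← Finset.sum_sub_distrib, ← Finset.sum_add_distrib]
    exact Finset.sum_congr rfl fun i _ => by ring
  have hnoise2 : ∑ i, (q i - p i) ^ 2 ≤ ℓ * (σ / α) ^ 2 := by
    refine (Finset.sum_le_sum fun i _ => hnoise i).trans (le_of_eq ?_)
    simp
  have hPL := hφ.sub_le_norm_gradient_sq hμ hμ0 x y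
  rw [dotProduct_self_eq_norm_sq] at hgrad
  have hpsum : 1 / 4 * (2 * μ * (φ x - φ y)) ≤ ∑ i, p i ^ 2 := by
    rw [hp]; linarith
  have hquad : η * (η * inner ℝ g (Matrix.toEuclideanLin A g)) ≤ η * ∑ i, q i ^ 2 := by
    refine mul_le_mul_of_nonneg_left ?_ hη.le
    have := mul_le_mul_of_nonneg_left hAg hη.le
    rwa [mul_inv_cancel_left₀ hη.ne'] at this
  have e1 := mul_le_mul_of_nonneg_left hnoise2 hη.le
  have e2 := mul_le_mul_of_nonneg_left hpsum hη.le
  rw [hsq] at e1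
  rw [hstep, h1, hgp]
  nlinarith

end IsConvexQuadratic

end

/-! ### The iteration -/

theorem zooProg_run_succ_eq_zooStep {d ℓ : ℕ} (f : EuclideanSpace ℝ (Fin d) → ℝ) (α η : ℝ)
    (x₀ : EuclideanSpace ℝ (Fin d)) (T : ℕ) (S : Fin (T + 1) → Matrix (Fin d) (Fin ℓ) ℝ) :
    (zooProg α η x₀ (T + 1) S).run f =
      zooStep f α η ((zooProg α η x₀ T fun t => S t.castSucc).run f) (S (Fin.last T)) :=
  zooProg_run_succ f α η x₀ T S _ rfl

theorem measurable_sketchCol {d ℓ : ℕ} (i : Fin ℓ) :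
    Measurable fun S : Matrix (Fin d) (Fin ℓ) ℝ => sketchCol S i := by
  have h : Measurable fun (S : Matrix (Fin d) (Fin ℓ) ℝ) (j : Fin d) => S j i :=
    measurable_pi_lambda _ fun j => (measurable_pi_apply i).comp (measurable_pi_apply j)
  exact (WithLp.measurable_toLp 2 _).comp h

theorem measurable_zooStep {d ℓ : ℕ} {f : EuclideanSpace ℝ (Fin d) → ℝ} (hf : Measurable f)
    (α η : ℝ) : Measurable fun p : EuclideanSpace ℝ (Fin d) × Matrix (Fin d) (Fin ℓ) ℝ =>
      zooStep f α η p.1 p.2 := by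
  have hc : ∀ i, Measurable fun p : EuclideanSpace ℝ (Fin d) × Matrix (Fin d) (Fin ℓ) ℝ =>
      sketchCol p.2 i := fun i => (measurable_sketchCol i).comp measurable_snd
  unfold zooStep
  refine measurable_fst.sub (Measurable.const_smul (Finset.measurable_fun_sum _ fun i _ => ?_) η)
  exact (((hf.comp (measurable_fst.add ((hc i).const_smul α))).sub
    (hf.comp (measurable_fst.sub ((hc i).const_smul α)))).div_const _).smul (hc i)

theorem measurable_zooProg_run {d ℓ : ℕ} {f : EuclideanSpace ℝ (Fin d) → ℝ} (hf : Measurable f)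
    (α η : ℝ) (x₀ : EuclideanSpace ℝ (Fin d)) (T : ℕ) :
    Measurable fun S : Fin T → Matrix (Fin d) (Fin ℓ) ℝ => (zooProg α η x₀ T S).run f := by
  induction T with
  | zero => exact measurable_const
  | succ T ih =>
    simp only [zooProg_run_succ_eq_zooStep]
    exact (measurable_zooStep hf α η).comp ((ih.comp (measurable_pi_lambda _ fun t =>
      measurable_pi_apply _)).prodMk (measurable_pi_apply _))

/-- If `Y` is independent of `X` and every section of a measurable set has probability at least
`1 - δ` under the law of `Y`, then so has the set under the joint law. -/
theorem measure_compl_le_of_indepFun {Ω α β : Type*} [MeasurableSpace Ω] [MeasurableSpace α]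
    [MeasurableSpace β] {P : Measure Ω} [IsProbabilityMeasure P] {X : Ω → α} {Y : Ω → β}
    (hX : Measurable X) (hY : Measurable Y) (h : IndepFun X Y P) {G : Set (α × β)}
    (hG : MeasurableSet G) {δ : ℝ} (hδ : 0 ≤ δ)
    (hsec : ∀ x, 1 - δ ≤ (P.map Y).real {y | (x, y) ∈ G}) :
    P {ω | (X ω, Y ω) ∉ G} ≤ ENNReal.ofReal δ := by
  have : IsProbabilityMeasure (P.map X) := Measure.isProbabilityMeasure_map hX.aemeasurable
  have : IsProbabilityMeasure (P.map Y) := Measure.isProbabilityMeasure_map hY.aemeasurable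
  have h1 : P {ω | (X ω, Y ω) ∉ G} = P.map (fun ω => (X ω, Y ω)) Gᶜ :=
    (Measure.map_apply (hX.prodMk hY) hG.compl).symm
  rw [h1, h.map_prod_eq_prod_map_map hX.aemeasurable hY.aemeasurable,
    Measure.prod_apply hG.compl]
  calc ∫⁻ x, P.map Y (Prod.mk x ⁻¹' Gᶜ) ∂P.map X ≤ ∫⁻ _, ENNReal.ofReal δ ∂P.map X := by
        refine lintegral_mono fun x => ?_
        have h2 := probReal_compl_eq_one_sub (μ := P.map Y) (measurable_prodMk_left hG (x := x))
        rw [ENNReal.le_ofReal_iff_toReal_le (measure_ne_top _ _) hδ]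
        have h3 := hsec x
        change (P.map Y).real (Prod.mk x ⁻¹' G)ᶜ ≤ δ
        rw [h2]
        have h4 : {y | (x, y) ∈ G} = Prod.mk x ⁻¹' G := rfl
        rw [h4] at h3
        linarith
    _ = ENNReal.ofReal δ := by simp

/-- The past sketches are jointly independent of the next one. -/
theorem indepFun_castSucc_last {Ω β : Type*} [MeasurableSpace Ω] [MeasurableSpace β]
    {P : Measure Ω} {T : ℕ} {S : Fin (T + 1) → Ω → β} (hS : ∀ t, Measurable (S t))
    (hind : iIndepFun S P) :
    IndepFun (fun ω (t : Fin T) => S t.castSucc ω) (S (Fin.last T)) P := by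
  classical
  have h := hind.indepFun_finset {Fin.last T}ᶜ {Fin.last T} disjoint_compl_left hS
  have hmem : ∀ t : Fin T, t.castSucc ∈ ({Fin.last T}ᶜ : Finset (Fin (T + 1))) := fun t => by
    simp [Fin.ext_iff, t.2.ne]
  have h1 : Measurable fun (a : ({Fin.last T}ᶜ : Finset (Fin (T + 1))) → β) (t : Fin T) =>
      a ⟨t.castSucc, hmem t⟩ := by fun_prop
  have h2 : Measurable fun a : ({Fin.last T} : Finset (Fin (T + 1))) → β =>
      a ⟨Fin.last T, Finset.mem_singleton_self _⟩ := by fun_prop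
  exact h.comp h1 h2

/-- If, for each fixed point, a step contracts the gap `Φ` up to an additive error except with
probability `δ`, then `T` steps with independent sketches do so except with probability `T δ`. -/
theorem measure_zooProg_gap_gt_le {d ℓ : ℕ} {f Φ : EuclideanSpace ℝ (Fin d) → ℝ}
    (hf : Measurable f) (hΦ : Measurable Φ) {α η r e δ : ℝ} (hr : r ≤ 1) (hδ : 0 ≤ δ)
    (x₀ : EuclideanSpace ℝ (Fin d)) {Ω : Type*} [MeasurableSpace Ω] {P : Measure Ω}
    [IsProbabilityMeasure P] (T : ℕ) (S : Fin T → Ω → Matrix (Fin d) (Fin ℓ) ℝ)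
    (hS : ∀ t, Measurable (S t)) (hind : iIndepFun S P)
    (hstep : ∀ t x, 1 - δ ≤ (P.map (S t)).real
      {M | Φ (zooStep f α η x M) ≤ (1 - r) * Φ x + r * e}) :
    P {ω | (1 - r) ^ T * Φ x₀ + e * (1 - (1 - r) ^ T) <
      Φ ((zooProg α η x₀ T fun t => S t ω).run f)} ≤ ENNReal.ofReal (T * δ) := by
  induction T with
  | zero => simp [zooProg, OracleProg.run]
  | succ T ih =>
    have h1 := ih (fun t => S t.castSucc) (fun t => hS _)
      (hind.precomp (Fin.castSucc_injective T)) fun t x => hstep _ x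
    have hX : Measurable fun ω => (zooProg α η x₀ T fun t => S t.castSucc ω).run f :=
      (measurable_zooProg_run hf α η x₀ T).comp (measurable_pi_lambda _ fun t => hS _)
    have hindep : IndepFun (fun ω => (zooProg α η x₀ T fun t => S t.castSucc ω).run f)
        (S (Fin.last T)) P :=
      (indepFun_castSucc_last hS hind).comp (measurable_zooProg_run hf α η x₀ T) measurable_id
    have hG : MeasurableSet {p : EuclideanSpace ℝ (Fin d) × Matrix (Fin d) (Fin ℓ) ℝ |
        Φ (zooStep f α η p.1 p.2) ≤ (1 - r) * Φ p.1 + r * e} :=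
      measurableSet_le (hΦ.comp (measurable_zooStep hf α η))
        (((hΦ.comp measurable_fst).const_mul _).add_const _)
    have h2 := measure_compl_le_of_indepFun hX (hS _) hindep hG hδ fun x => hstep (Fin.last T) x
    have h3 : ENNReal.ofReal ((T + 1 : ℕ) * δ) = ENNReal.ofReal (T * δ) + ENNReal.ofReal δ := by
      rw [← ENNReal.ofReal_add (by positivity) hδ]
      push_cast
      ring_nf
    rw [h3]
    refine (measure_mono fun ω hω => ?_).trans ((measure_union_le _ _).trans (add_le_add h1 h2))
    by_contra hcon
    rw [Set.mem_union, not_or] at hcon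
    simp only [Set.mem_ofPred_eq, not_not, not_lt] at hcon hω
    rw [zooProg_run_succ_eq_zooStep] at hω
    have h4 := mul_le_mul_of_nonneg_left hcon.1 (sub_nonneg.2 hr)
    have h5 := hcon.2
    rw [pow_succ] at hω
    nlinarith

/-! ### Query count and conclusion -/

theorem OracleProg.queries_bind {X β γ : Type} (f : X → ℝ) (p : OracleProg X β)
    (g : β → OracleProg X γ) :
    (p.bind g).queries f = p.queries f + (g (p.run f)).queries f := by
  induction p with
  | pure b => simp [OracleProg.bind, OracleProg.queries, OracleProg.run]
  | query x next ih =>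
    simp only [OracleProg.bind, OracleProg.queries, OracleProg.run, ih]
    omega

theorem gradProg_queries {d ℓ : ℕ} (f : EuclideanSpace ℝ (Fin d) → ℝ) (α : ℝ)
    (S : Matrix (Fin d) (Fin ℓ) ℝ) (x : EuclideanSpace ℝ (Fin d)) (is : List (Fin ℓ))
    (g : EuclideanSpace ℝ (Fin d)) : (gradProg α S x is g).queries f = 2 * is.length := by
  induction is generalizing g with
  | nil => rfl
  | cons i is ih => simp only [gradProg, OracleProg.queries, ih, List.length_cons]; omega

theorem zooProg_queries {d ℓ : ℕ} (f : EuclideanSpace ℝ (Fin d) → ℝ) (α η : ℝ)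
    (x₀ : EuclideanSpace ℝ (Fin d)) (T : ℕ) (S : Fin T → Matrix (Fin d) (Fin ℓ) ℝ) :
    (zooProg α η x₀ T S).queries f = 2 * ℓ * T := by
  induction T with
  | zero => rfl
  | succ T ih =>
    simp only [zooProg, OracleProg.queries_bind, ih, gradProg_queries, OracleProg.queries,
      List.length_finRange]
    ring

/-- The empty matrix is not a sketch: it would annihilate a rank-one projection. -/
theorem IsObliviousSketch.pos {d ℓ : ℕ} {ν : Measure (Matrix (Fin d) (Fin ℓ) ℝ)} {k δ : ℝ}
    (h : IsObliviousSketch ν (1 / 4) k δ) (hd : 0 < d) (hk : 1 ≤ k) (hδ : δ < 1) : 0 < ℓ := by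
  rcases Nat.eq_zero_or_pos ℓ with rfl | h0
  swap
  · exact h0
  exfalso
  obtain ⟨u, hu⟩ : ∃ u : Fin d → ℝ, u = Pi.single ⟨0, hd⟩ 1 := ⟨_, rfl⟩
  have huu : u ⬝ᵥ u = 1 := by rw [hu]; simp
  obtain ⟨B, hB⟩ : ∃ B : Matrix (Fin d) (Fin d) ℝ, B = Matrix.vecMulVec u u := ⟨_, rfl⟩
  have hBx : ∀ x : Fin d → ℝ, B.mulVec x = (u ⬝ᵥ x) • u := fun x => by
    rw [hB, Matrix.vecMulVec_mulVec]; simp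
  have hspec : specNorm B ≤ 1 := by
    refine specNorm_le_of_forall_abs_le ?_ zero_le_one fun x => ?_
    · rw [hB, Matrix.IsHermitian, Matrix.conjTranspose_eq_transpose_of_trivial,
        Matrix.transpose_vecMulVec]
    · have h1 := dotProduct_sq_le u x
      rw [hBx, dotProduct_smul, smul_eq_mul, dotProduct_comm x u, abs_of_nonneg
        (mul_self_nonneg _), ← sq]
      rwa [huu] at h1
  have hfrob : frobSq B = 1 := by
    have hBt : B.transpose = B := by rw [hB, Matrix.transpose_vecMulVec]
    have hBB : B * B = B := by
      rw [hB, Matrix.vecMulVec_mul_vecMulVec, huu, one_smul]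
    rw [frobSq_eq_trace, hBt, hBB, hB, Matrix.trace_vecMulVec, huu]
  have hempty : {S : Matrix (Fin d) (Fin 0) ℝ | specNorm (B.transpose * S * S.transpose * B -
      B.transpose * B) ≤ 1 / 4 * (specNorm B ^ 2 + frobSq B / k)} = ∅ := by
    refine Set.eq_empty_of_forall_notMem fun S hS => ?_
    have h1 := abs_dotProduct_mulVec_le (B.transpose * S * S.transpose * B -
      B.transpose * B) u
    rw [dotProduct_sketch_mulVec, hBx, huu, one_smul] at h1
    simp only [Finset.univ_eq_empty, Finset.sum_empty, huu, zero_sub, abs_neg, abs_one,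
      mul_one] at h1
    have h2 : specNorm B ^ 2 ≤ 1 := by nlinarith [specNorm_nonneg B]
    have h3 : frobSq B / k ≤ 1 := by rw [hfrob]; exact div_le_one_of_le₀ hk (by linarith)
    have h4 := h1.trans hS
    linarith
  have h1 := h B
  rw [hempty, measureReal_empty] at h1
  linarith

theorem corollary1 :
    ∃ c : ℝ, 0 < c ∧
      -- Gaussian and Rademacher matrices with `ℓ ≥ c (k + log (1 / δ))` columns are sketches
      (∀ (d ℓ : ℕ) (k δ : ℝ), 1 ≤ k → 0 < δ → δ < 1 → c * (k + Real.log (1 / δ)) ≤ (ℓ : ℝ) →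
        IsObliviousSketch (gaussianSketch d ℓ) (1 / 4) k δ ∧
        IsObliviousSketch (rademacherSketch d ℓ) (1 / 4) k δ) ∧
      -- convergence and complexity, with constants that depend on `C₁` only
      ∀ C₁ : ℝ, 0 < C₁ → ∃ C C' : ℝ, 0 < C ∧ 0 < C' ∧
        ∀ (d ℓ T : ℕ) (k δ μ σ α ε : ℝ)
          (A : Matrix (Fin d) (Fin d) ℝ) (φ f : EuclideanSpace ℝ (Fin d) → ℝ)
          (x₀ xstar : EuclideanSpace ℝ (Fin d))
          (Ω : Type) [MeasurableSpace Ω] (P : Measure Ω) [IsProbabilityMeasure P]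
          (S : Fin T → Ω → Matrix (Fin d) (Fin ℓ) ℝ),
          0 < d → 0 < T → 1 ≤ k → 0 < δ → δ < 1 → 0 < μ → 0 ≤ σ → 0 < α → 0 < ε →
          -- the objective, its minimizer and the noisy oracle
          IsConvexQuadratic φ A → StrongConvexOn Set.univ μ φ → IsMinOn φ Set.univ xstar →
          Measurable f → (∀ x, |f x - φ x| ≤ σ) →
          -- the sketching matrices
          (∀ t, Measurable (S t)) → iIndepFun S P →
          (∀ t, IsObliviousSketch (P.map (S t)) (1 / 4) k (δ / T)) →
          (ℓ : ℝ) ≤ C₁ * (k + Real.log (T / δ)) → Real.log (T / δ) < k →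
          -- after `T = O((‖A‖₂ / μ + tr A / (μ ℓ)) log (1 / ε))` iterations
          (C * zooRate A μ ℓ * Real.log (max 1 (φ x₀ - φ xstar) / ε) ≤ (T : ℝ) →
            1 - δ ≤ P.real {ω |
              φ ((zooProg α (5 * specNorm A + A.trace / k)⁻¹ x₀ T fun t => S t ω).run f) - φ xstar
                ≤ ε + 3 * ℓ * σ ^ 2 / (μ * α ^ 2)}) ∧
          -- the total number of oracle queries
          (ε ≤ 1 / 2 →
            T ≤ ⌈C * zooRate A μ ℓ * Real.log (max 1 (φ x₀ - φ xstar) / ε)⌉₊ →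
            ∀ ω, ((zooProg α (5 * specNorm A + A.trace / k)⁻¹ x₀ T fun t => S t ω).queries f : ℝ)
              ≤ C' * (ℓ * specNorm A / μ + A.trace / μ) *
                Real.log (max 1 (φ x₀ - φ xstar) / ε)) := by
  refine ⟨10 ^ 12, by norm_num, fun d ℓ k δ hk hδ hδ1 hℓ =>
    ⟨isObliviousSketch_gaussianSketch hk hδ hδ1 hℓ,
      isObliviousSketch_rademacherSketch hk hδ hδ1 hℓ⟩, fun C₁ hC₁ =>
    ⟨20 + 8 * C₁, 2 * (22 + 8 * C₁), by positivity, by positivity, ?_⟩⟩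
  intro d ℓ T k δ μ σ α ε A φ f x₀ xstar Ω _ P _ S hd hT hk hδ hδ1 hμ hσ hα hε hφ hsc hmin hf hfφ
    hS hind hsk hℓ hlog
  have hk0 : 0 < k := by linarith
  have hT1 : (1 : ℝ) ≤ T := by exact_mod_cast hT
  -- with `ℓ = 0` the term `tr A / (μ ℓ)` of the rate would be the junk value `0`
  have hℓ0 : 0 < ℓ := (hsk ⟨0, hT⟩).pos hd hk ((div_le_self hδ.le hT1).trans_lt hδ1)
  have hℓ' : (0 : ℝ) < ℓ := by exact_mod_cast hℓ0
  have hA := hφ.posDef_of_strongConvexOn hsc hμ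
  have haμ := hφ.le_specNorm_of_strongConvexOn hsc hd
  have ha : 0 < specNorm A := hμ.trans_le haμ
  have htr : 0 ≤ A.trace := hφ.posSemidef.trace_nonneg
  have hrate1 : 1 ≤ zooRate A μ ℓ := by
    have h1 : 1 ≤ specNorm A / μ := (one_le_div hμ).2 haμ
    have h2 : 0 ≤ A.trace / (μ * ℓ) := by positivity
    unfold zooRate
    linarith
  obtain ⟨Λ, hΛ⟩ : ∃ Λ, Λ = Real.log (max 1 (φ x₀ - φ xstar) / ε) := ⟨_, rfl⟩
  rw [← hΛ]
  refine ⟨fun hCT => ?_, fun hε2 hTle ω => ?_⟩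
  · obtain ⟨η, hη⟩ : ∃ η, η = (5 * specNorm A + A.trace / k)⁻¹ := ⟨_, rfl⟩
    have hη0 : 0 < η := by rw [hη]; positivity
    have hηinv : η⁻¹ = 5 * specNorm A + A.trace / k := by rw [hη, inv_inv]
    rw [← hη]
    obtain ⟨r, hr⟩ : ∃ r, r = η * μ / 4 := ⟨_, rfl⟩
    have hr0 : 0 < r := by rw [hr]; positivity
    have hr1 : r ≤ 1 := by
      have h1 : η * μ ≤ η * η⁻¹ := by
        refine mul_le_mul_of_nonneg_left ?_ hη0.le
        rw [hηinv]
        have : 0 ≤ A.trace / k := by positivity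
        linarith
      rw [mul_inv_cancel₀ hη0.ne'] at h1
      rw [hr]; linarith
    -- the fixed point of the noise recursion, below the `3 ℓ σ² / (μ α²)` allowed
    obtain ⟨e, he⟩ : ∃ e, e = 2 * ℓ * σ ^ 2 / (μ * α ^ 2) := ⟨_, rfl⟩
    have he0 : 0 ≤ e := by rw [he]; positivity
    have hre : η / 2 * (ℓ * (σ / α) ^ 2) = r * e := by
      rw [hr, he]; field_simp; ring
    obtain ⟨Φ, hΦ⟩ : ∃ Φ : EuclideanSpace ℝ (Fin d) → ℝ, Φ = fun x => φ x - φ xstar := ⟨_, rfl⟩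
    have hΦm : Measurable Φ := by
      rw [hΦ]; exact (hφ.differentiable.continuous.sub continuous_const).measurable
    have hΦ0 : 0 ≤ Φ x₀ := by rw [hΦ]; exact sub_nonneg.2 (hmin (Set.mem_univ _))
    have hmain := measure_zooProg_gap_gt_le hf hΦm (α := α) (η := η) (r := r) (e := e)
      (δ := δ / T) hr1 (by positivity) x₀ T S hS hind fun t x => by
        have : IsProbabilityMeasure (P.map (S t)) :=
          Measure.isProbabilityMeasure_map (hS t).aemeasurable
        refine ((hsk t).le_measureReal_curvature_and_gradient hk hA ha (∇ φ x).ofLp).trans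
          (measureReal_mono fun M hM => ?_)
        rw [← hηinv] at hM
        have := hφ.zooStep_sub_le hsc hμ hα hη0 hfφ (y := xstar) hM.1 hM.2
        rw [hre, ← hr] at this
        rw [hΦ]
        exact this
    rw [mul_div_cancel₀ _ (by positivity : (T : ℝ) ≠ 0)] at hmain
    refine one_sub_le_measureReal hδ.le ((measure_mono fun ω hω => ?_).trans hmain)
    by_contra hcon
    simp only [Set.mem_ofPred_eq, not_lt] at hcon
    refine hω ?_
    have hpow : (1 - r) ^ T * Φ x₀ ≤ ε := by
      have h1 : (1 - r) ^ T ≤ Real.exp (-(r * T)) := by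
        calc (1 - r) ^ T ≤ Real.exp (-r) ^ T :=
              pow_le_pow_left₀ (by linarith) (Real.one_sub_le_exp_neg r) _
          _ = Real.exp (-(r * T)) := by rw [← Real.exp_nat_mul]; ring_nf
      have hrT : Λ ≤ r * T := by
        rcases le_or_gt Λ 0 with h0 | h0
        · exact h0.trans (by positivity)
        -- `ℓ ≤ 2 C₁ k` turns `tr A / k` into `tr A / ℓ`
        have h2 : 1 ≤ r * ((20 + 8 * C₁) * zooRate A μ ℓ) := by
          have hℓk : (ℓ : ℝ) ≤ 2 * C₁ * k := by nlinarith
          have h3 : A.trace / k ≤ 2 * C₁ * (A.trace / ℓ) := by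
            rw [div_le_iff₀ hk0, mul_assoc, div_mul_eq_mul_div, ← mul_div_assoc, le_div_iff₀ hℓ']
            nlinarith
          have h4 : η⁻¹ * 4 ≤ (20 + 8 * C₁) * (specNorm A + A.trace / ℓ) := by
            have h5 : 0 ≤ A.trace / ℓ := by positivity
            rw [hηinv]
            nlinarith [mul_pos hC₁ ha]
          have h5 : zooRate A μ ℓ = (specNorm A + A.trace / ℓ) / μ := by
            unfold zooRate; field_simp
          rw [h5, hr]
          calc (1 : ℝ) = η * μ / 4 * (η⁻¹ * 4 / μ) := by field_simp
            _ ≤ η * μ / 4 * ((20 + 8 * C₁) * (specNorm A + A.trace / ℓ) / μ) := by gcongr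
            _ = _ := by ring
        calc Λ ≤ r * ((20 + 8 * C₁) * zooRate A μ ℓ) * Λ := le_mul_of_one_le_left h0.le h2
          _ = r * ((20 + 8 * C₁) * zooRate A μ ℓ * Λ) := by ring
          _ ≤ r * T := mul_le_mul_of_nonneg_left hCT hr0.le
      have hmax : 0 < max 1 (φ x₀ - φ xstar) := lt_max_of_lt_left one_pos
      have hexp : Real.exp (-Λ) = ε / max 1 (φ x₀ - φ xstar) := by
        rw [hΛ, Real.exp_neg, Real.exp_log (by positivity), inv_div]
      calc (1 - r) ^ T * Φ x₀ ≤ Real.exp (-Λ) * Φ x₀ :=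
            mul_le_mul_of_nonneg_right (h1.trans (Real.exp_le_exp.2 (by linarith))) hΦ0
        _ ≤ Real.exp (-Λ) * max 1 (φ x₀ - φ xstar) :=
            mul_le_mul_of_nonneg_left (by rw [hΦ]; exact le_max_right _ _) (Real.exp_pos _).le
        _ = ε := by rw [hexp]; field_simp
    have hnoise : e * (1 - (1 - r) ^ T) ≤ 3 * ℓ * σ ^ 2 / (μ * α ^ 2) := by
      have h1 : 0 ≤ (1 - r) ^ T := pow_nonneg (by linarith) _
      refine (mul_le_of_le_one_right he0 (by linarith)).trans ?_
      rw [he]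
      gcongr
      norm_num
    have hΦω : Φ ((zooProg α η x₀ T fun t => S t ω).run f) =
      φ ((zooProg α η x₀ T fun t => S t ω).run f) - φ xstar := by rw [hΦ]
    rw [hΦω] at hcon
    exact hcon.trans (add_le_add hpow hnoise)
  -- `Λ ≥ log 2` and the rate is at least `1`, so rounding up costs a constant factor
  · have hΛ1 : 1 / 2 ≤ Λ := by
      have h1 : 2 ≤ max 1 (φ x₀ - φ xstar) / ε := by
        rw [le_div_iff₀ hε]
        linarith [le_max_left 1 (φ x₀ - φ xstar)]
      rw [hΛ]
      refine le_trans ?_ (Real.log_le_log (by norm_num) h1)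
      linarith [Real.log_two_gt_d9]
    have hRΛ : 1 / 2 ≤ zooRate A μ ℓ * Λ := by nlinarith
    have h1 : (T : ℝ) ≤ (22 + 8 * C₁) * (zooRate A μ ℓ * Λ) := by
      have h2 : (T : ℝ) ≤ (⌈(20 + 8 * C₁) * zooRate A μ ℓ * Λ⌉₊ : ℝ) := by exact_mod_cast hTle
      have h3 := Nat.ceil_lt_add_one (a := (20 + 8 * C₁) * zooRate A μ ℓ * Λ) (by positivity)
      linarith
    rw [zooProg_queries]
    push_cast
    calc (2 * ℓ * T : ℝ) ≤ 2 * ℓ * ((22 + 8 * C₁) * (zooRate A μ ℓ * Λ)) :=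
          mul_le_mul_of_nonneg_left h1 (by positivity)
      _ = _ := by
        unfold zooRate
        field_simp
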